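/- Write $f(u)\sim g(u)$ as $u\to\infty$ for $f(u)-g(u)=o(g(u))$ (so $f/g\to1$ when $g$ is eventually nonzero, and $f$ vanishes eventually if $g$ does). A Lévy measure on $(0,\infty)$ is a Borel measure $\rho$ with $\int_0^\infty\min(1,w)\,\rho(dw)<\infty$; put $\overline\rho(x)=\rho((x,\infty))$ for $x>0$. For $a\ge 0$, $\mathrm{ID}(a,\rho)$ is the law on $[0,\infty)$ with Laplace transform $t\mapsto\exp\bigl(-ta-\int_0^\infty(1-e^{-wt})\,\rho(dw)\bigr)$, $t\ge0$. Let $\varphi$ be the standard normal density and let $\phi(z)=\max(z,0)$ be the ReLU function. Let $L\ge1$, $d_{\mathrm{in}}\ge1$, $\mathbf x\in\mathbb R^{d_{\mathrm{in}}}$, $\sigma_v>0$, $a\ge0$, and let $\rho$ be a Lévy measure on $(0,\infty)$ with $\overline\rho(x)\sim c\,x^{-\tau}$ as $x\to\infty$, for constants $c>0$, $\tau>0$. Let $S^{(1)},\dots,S^{(L)}$ be independent random variables, each with law $\mathrm{ID}(c_\phi,\eta)$, where $c_\phi=a\int_{-\infty}^{\infty}\phi(z)^2\varphi(z)\,dz$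 and $\eta$ is the Lévy measure on $(0,\infty)$ with tail $\overline\eta(x)=\int_{\{z:\phi(z)\ne0\}}\overline\rho(x/\phi(z)^2)\,\varphi(z)\,dz$. Define (the infinite-width limiting variances of a ReLU network without bias and with identically distributed layers) $$\Sigma^{(1)}(\mathbf x)=\sigma_v^2\frac{\|\mathbf x\|^2}{d_{\mathrm{in}}},\qquad \Sigma^{(l)}(\mathbf x)=\sigma_v^2\,S^{(l-1)}\,\Sigma^{(l-1)}(\mathbf x)\quad(2\le l\le L+1),$$ and, for $k\ge1$ and $2\le l\le L+1$, the limiting pre-activations/outputs $\zeta^{(l)}_k(\mathbf x)=\varepsilon^{(l)}_k\sqrt{\Sigma^{(l)}(\mathbf x)}$, where $\varepsilon_k^{(l)}\sim\mathcal N(0,1)$ is independent of $\Sigma^{(l)}(\mathbf x)$. Then for every $l=2,\dots,L+1$ and every $k\ge1$, as $u\to\infty$, $$\Pr(\Sigma^{(l)}(\mathbf x)>u)\sim\Bigl(\frac{\|\mathbf x\|^2}{d_{\mathrm{in}}}\sigma_v^{2l}\Bigr)^{\tau}\,\frac{\tau^{l-2}\,\widetilde c^{\,l-1}}{(l-2)!}\,u^{-\tau}\log^{l-2}u,\qquad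 \widetilde c=c\,\frac{2^{\tau-1}\Gamma(\tau+1/2)}{\sqrt\pi},$$ $$\Pr\bigl((\zeta_k^{(l)}(\mathbf x))^2>u\bigr)\sim\Pr(\Sigma^{(l)}(\mathbf x)>u)\times\frac{2^{\tau}\,\Gamma(\tau+1/2)}{\Gamma(1/2)}.$$ -/

import Mathlib

open MeasureTheory ProbabilityTheory Filter Set

/-- A Lévy measure on `(0, ∞)`, seen as a Borel measure on `ℝ` that does not charge `(-∞, 0]`:
`∫ min(1, w) ρ(dw) < ∞`. -/
structure IsLevyMeasure (ρ : Measure ℝ) : Prop where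
  null_Iic : ρ (Iic 0) = 0
  lintegral_lt_top : ∫⁻ w, ENNReal.ofReal (min 1 w) ∂ρ < ⊤

/-- The tail Lévy intensity `x ↦ ρ((x, ∞))` (finite for `x > 0` when `ρ` is a Lévy measure). -/
noncomputable def levyTail (ρ : Measure ℝ) (x : ℝ) : ℝ := ρ.real (Ioi x)

/-- `μ` is the law `ID(a, ρ)`: the nonnegative infinitely divisible distribution with location
`a` and Lévy measure `ρ`, characterised by its Laplace transform. -/
structure IsInfDivLaw (a : ℝ) (ρ : Measure ℝ) (μ : Measure ℝ) : Prop where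
  prob : IsProbabilityMeasure μ
  nonneg : μ (Iio 0) = 0
  laplace : ∀ t : ℝ, 0 ≤ t →
    ∫ s, Real.exp (-(t * s)) ∂μ =
      Real.exp (-(t * a) - ∫ w, (1 - Real.exp (-(w * t))) ∂ρ)

/-- The rectified linear unit. -/
noncomputable def relu (z : ℝ) : ℝ := max z 0

/-- The location parameter `a ∫ φ(z)² N(0,1)(dz)`. -/
noncomputable def activationLocation (φ : ℝ → ℝ) (a : ℝ) : ℝ :=
  a * ∫ z, φ z ^ 2 ∂(gaussianReal 0 1)

/-- The image of `ρ ⊗ N(0,1)` under `(w, z) ↦ w φ(z)²`, restricted to `(0, ∞)`. Its tail is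
computed in `activationLevy_Ioi`. -/
noncomputable def activationLevy (φ : ℝ → ℝ) (ρ : Measure ℝ) : Measure ℝ :=
  ((ρ.prod (gaussianReal 0 1)).map fun p : ℝ × ℝ => p.1 * φ p.2 ^ 2).restrict (Ioi 0)

/-- The limiting variances `Σ⁽ˡ⁾(x)`, `l ≥ 1`, with
`Σ⁽¹⁾ = σ_b² + σ_v² ‖x‖² / d` and `Σ⁽ˡ⁾ = σ_b² + σ_v² S⁽ˡ⁻¹⁾ Σ⁽ˡ⁻¹⁾` for `l ≥ 2`.
The value at `l = 0` is a dummy. -/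
noncomputable def limitVariance {Ω : Type*} (σb σv : ℝ) {d : ℕ} (x : EuclideanSpace ℝ (Fin d))
    (S : ℕ → Ω → ℝ) : ℕ → Ω → ℝ
  | 0 => fun _ => 0
  | 1 => fun _ => σb ^ 2 + σv ^ 2 * ‖x‖ ^ 2 / d
  | l + 2 => fun ω => σb ^ 2 + σv ^ 2 * S (l + 1) ω * limitVariance σb σv x S (l + 1) ω

theorem IsLevyMeasure.sigmaFinite {ρ : Measure ℝ} (h : IsLevyMeasure ρ) : SigmaFinite ρ := by
  refine ⟨⟨⟨fun n : ℕ => Iic 0 ∪ Ici (1 / ((n : ℝ) + 1)), fun _ => trivial, fun n => ?_, ?_⟩⟩⟩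
  · have hn : (0 : ℝ) < 1 / ((n : ℝ) + 1) := by positivity
    have hn1 : 1 / ((n : ℝ) + 1) ≤ 1 := by
      rw [div_le_one (by positivity)]
      linarith [(Nat.cast_nonneg n : (0 : ℝ) ≤ n)]
    refine (measure_union_le _ _).trans_lt ?_
    rw [h.null_Iic, zero_add]
    have hm := meas_ge_le_lintegral_div (μ := ρ) (f := fun w => ENNReal.ofReal (min 1 w))
      (by fun_prop) (ε := ENNReal.ofReal (1 / ((n : ℝ) + 1)))
      (by simpa using hn) ENNReal.ofReal_ne_top
    refine (measure_mono fun w hw => ?_).trans_lt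
      (hm.trans_lt (ENNReal.div_lt_top h.lintegral_lt_top.ne (by simpa using hn)))
    exact ENNReal.ofReal_le_ofReal (le_min hn1 hw)
  · refine eq_univ_of_forall fun w => ?_
    rcases le_or_gt w 0 with hw | hw
    · exact mem_iUnion.2 ⟨0, Or.inl hw⟩
    · obtain ⟨n, hn⟩ := exists_nat_one_div_lt hw
      exact mem_iUnion.2 ⟨n, Or.inr hn.le⟩

/-- The tail of `activationLevy φ ρ` is `x ↦ ∫_{φ(z) ≠ 0} ρ((x / φ(z)², ∞)) N(0,1)(dz)`. -/
theorem activationLevy_Ioi {φ : ℝ → ℝ} (hφ : Measurable φ) {ρ : Measure ℝ} (h : IsLevyMeasure ρ)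
    {x : ℝ} (hx : 0 < x) :
    activationLevy φ ρ (Ioi x) =
      ∫⁻ z in {z | φ z ≠ 0}, ρ (Ioi (x / φ z ^ 2)) ∂(gaussianReal 0 1) := by
  have := h.sigmaFinite
  have hs : MeasurableSet {z | φ z ≠ 0} := (measurableSet_singleton 0).compl.preimage hφ
  have hf : Measurable fun p : ℝ × ℝ => p.1 * φ p.2 ^ 2 := by fun_prop
  rw [activationLevy, Measure.restrict_apply measurableSet_Ioi,
    inter_eq_left.2 (Ioi_subset_Ioi hx.le), Measure.map_apply hf measurableSet_Ioi,
    Measure.prod_apply_symm (hf measurableSet_Ioi), ← lintegral_indicator hs]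
  refine lintegral_congr fun z => ?_
  by_cases hz : φ z = 0
  · have : (fun w : ℝ => (w, z)) ⁻¹' ((fun p : ℝ × ℝ => p.1 * φ p.2 ^ 2) ⁻¹' Ioi x) = ∅ := by
      ext w; simp [hz, hx.le]
    simp [this, hz]
  · rw [indicator_of_mem (by exact hz)]
    congr 1
    ext w
    simp only [mem_preimage, mem_Ioi]
    rw [div_lt_iff₀ (by positivity)]

/-! Without bias, `Σ⁽ˡ⁾` is a constant times a product of `l - 1` independent copies of one variable
`S`, so everything rests on the tail of `S` and on how tails of products behave.

The tail of `S` takes two steps. The Lévy measure `η` is a multiplicative Gaussian mixture of `ρ`,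
and Breiman's lemma (`HasLogPowerTail.integral_comp_div`) multiplies the constant `c` by
`E[relu(Z)^(2τ)]`, which gives `c̃`. Then an infinitely divisible law on `[0, ∞)` inherits the power
tail of its Lévy measure (`IsInfDivLaw.tendsto_rpow_mul_tail`). The latter comes from Steutel's
identity `s μ(ds) = a μ(ds) + (μ * w η(dw))(ds)`: dividing by `s` and integrating over `(x, ∞)`
expresses the tail of `μ` through the tail of `η` near `x`, plus terms that are negligible relative
to the tail of `μ` at `x` and `x/2`.

For the product, let `P(V > u) ~ K u^(-τ) log^m u` and `P(S > u) ~ c̃ u^(-τ)`. Breiman's lemma is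
unavailable, since the `τ`-th moments may be infinite. Instead `P(SV > u)` is close to `c̃ u^(-τ)
E[min(V, u)^τ]`, and the truncated moment `τ ∫₀ᵘ P(V > t) t^(τ-1) dt` grows like `τ K log^(m+1) u /
(m+1)` (`HasLogPowerTail.mul`). Each layer thus adds one logarithm and a factor `τ c̃ / (m+1)`;
iteration produces `τ^(l-2) c̃^(l-1) / (l-2)!`. The squared Gaussian factor of the output has all
moments, so Breiman's lemma applies again and contributes only `E[|ε|^(2τ)]`. -/

/-! ### Laplace transforms and Steutel's identity -/

/-- Finite measures on `[0, ∞)` are determined by the values of their Laplace transforms at the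
natural numbers. -/
theorem Measure.ext_of_laplace_natCast {α β : Measure ℝ} [IsFiniteMeasure α] [IsFiniteMeasure β]
    (hα : α (Iio 0) = 0) (hβ : β (Iio 0) = 0)
    (h : ∀ n : ℕ, ∫⁻ s, ENNReal.ofReal (Real.exp (-(n * s))) ∂α =
      ∫⁻ s, ENNReal.ofReal (Real.exp (-(n * s))) ∂β) : α = β := by
  have hg : Measurable fun s : ℝ => Real.exp (-s) := by fun_prop
  have hsupp : ∀ γ : Measure ℝ, γ (Iio 0) = 0 → ∀ᵐ s ∂γ, Real.exp (-s) ∈ Icc (0 : ℝ) 1 := by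
    intro γ hγ
    have : ∀ᵐ s ∂γ, s ∉ Iio (0 : ℝ) := measure_eq_zero_iff_ae_notMem.1 hγ
    filter_upwards [this] with s hs
    exact ⟨(Real.exp_pos _).le, Real.exp_le_one_iff.2 (by simpa using hs)⟩
  have hpow : ∀ γ : Measure ℝ, IsFiniteMeasure γ → γ (Iio 0) = 0 → ∀ n : ℕ,
      Integrable (fun s => Real.exp (-s) ^ n) γ := by
    intro γ _ hγ n
    refine Integrable.mono' (integrable_const (1 : ℝ)) (by fun_prop) ?_
    filter_upwards [hsupp γ hγ] with s hs
    rw [Real.norm_of_nonneg (pow_nonneg hs.1 _)]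
    exact pow_le_one₀ hs.1 hs.2
  have hmom : ∀ n : ℕ, ∫ s, Real.exp (-s) ^ n ∂α = ∫ s, Real.exp (-s) ^ n ∂β := by
    intro n
    have e : ∀ s : ℝ, Real.exp (-s) ^ n = Real.exp (-(n * s)) := fun s => by
      rw [← Real.exp_nat_mul]; ring_nf
    simp_rw [e]
    rw [integral_eq_lintegral_of_nonneg_ae (ae_of_all _ fun s => (Real.exp_pos _).le)
      (by fun_prop), integral_eq_lintegral_of_nonneg_ae
      (ae_of_all _ fun s => (Real.exp_pos _).le) (by fun_prop), h n]
  have hpint : ∀ γ : Measure ℝ, IsFiniteMeasure γ → γ (Iio 0) = 0 → ∀ p : Polynomial ℝ,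
      Integrable (fun s => p.eval (Real.exp (-s))) γ := by
    intro γ _ hγ p
    simp_rw [Polynomial.eval_eq_sum_range]
    exact integrable_finsetSum _ fun i _ => (hpow γ ‹_› hγ i).const_mul _
  have hpoly : ∀ p : Polynomial ℝ, ∫ s, p.eval (Real.exp (-s)) ∂α =
      ∫ s, p.eval (Real.exp (-s)) ∂β := by
    intro p
    simp_rw [Polynomial.eval_eq_sum_range]
    rw [integral_finsetSum _ fun i _ => (hpow α ‹_› hα i).const_mul _,
      integral_finsetSum _ fun i _ => (hpow β ‹_› hβ i).const_mul _]
    simp_rw [integral_const_mul, hmom]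
  -- Under `s ↦ exp (-s)` the measures move to `[0, 1]` and the Laplace values become moments;
  -- polynomials are uniformly dense there, so the moments decide. The map is undone by `-log`.
  have key : α.map (fun s : ℝ => Real.exp (-s)) = β.map (fun s : ℝ => Real.exp (-s)) := by
    refine ext_of_forall_integral_eq_of_IsFiniteMeasure fun f => ?_
    rw [integral_map hg.aemeasurable (by fun_prop), integral_map hg.aemeasurable (by fun_prop)]
    have hfi : ∀ γ : Measure ℝ, IsFiniteMeasure γ → Integrable (fun s => f (Real.exp (-s))) γ := by
      intro γ _
      refine Integrable.mono' (integrable_const ‖f‖) (by fun_prop) (ae_of_all _ fun s => ?_)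
      exact f.norm_coe_le_norm _
    have hnear : ∀ γ : Measure ℝ, IsFiniteMeasure γ → γ (Iio 0) = 0 → ∀ p : Polynomial ℝ,
        ∀ δ : ℝ, (∀ y ∈ Icc (0 : ℝ) 1, |p.eval y - f y| < δ) →
        |∫ s, p.eval (Real.exp (-s)) ∂γ - ∫ s, f (Real.exp (-s)) ∂γ| ≤ δ * γ.real univ := by
      intro γ _ hγ p δ hp
      rw [← integral_sub (hpint γ ‹_› hγ p) (hfi γ ‹_›)]
      rw [← Real.norm_eq_abs]
      refine norm_integral_le_of_norm_le_const ?_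
      filter_upwards [hsupp γ hγ] with s hs using (hp _ hs).le
    refine eq_of_forall_dist_le fun e he => ?_
    rw [Real.dist_eq]
    set M := α.real univ + β.real univ + 1 with hM
    have hMpos : 0 < M := by positivity
    obtain ⟨p, hp⟩ := exists_polynomial_near_of_continuousOn 0 1 f f.continuous.continuousOn
      (e / M) (by positivity)
    have h1 := hnear α ‹_› hα p _ hp
    have h2 := hnear β ‹_› hβ p _ hp
    rw [hpoly p] at h1
    have h3 : e / M * α.real univ + e / M * β.real univ ≤ e := by
      rw [← mul_add, div_mul_eq_mul_div, div_le_iff₀ hMpos]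
      exact mul_le_mul_of_nonneg_left (by rw [hM]; linarith) he.le
    rw [abs_le] at h1 h2 ⊢
    constructor <;> linarith [h1.1, h1.2, h2.1, h2.2]
  have hback : ∀ γ : Measure ℝ,
      (γ.map fun s : ℝ => Real.exp (-s)).map (fun y => -Real.log y) = γ := by
    intro γ
    rw [Measure.map_map (by fun_prop) hg]
    have : (fun y : ℝ => -Real.log y) ∘ (fun s : ℝ => Real.exp (-s)) = id := by
      ext s; simp
    rw [this, Measure.map_id]
  rw [← hback α, ← hback β, key]

theorem integrable_min_one_of_lintegral {ν : Measure ℝ} (hν : ∀ᵐ w ∂ν, 0 ≤ w)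
    (h : ∫⁻ w, ENNReal.ofReal (min 1 w) ∂ν < ⊤) : Integrable (fun w => min 1 w) ν := by
  refine ⟨by fun_prop, ?_⟩
  rw [hasFiniteIntegral_iff_ofReal]
  · exact h
  · filter_upwards [hν] with w hw using le_min zero_le_one hw

/-- Differentiation under the integral: for parameters above `t / 2` the derivative is at most both
`w` and `2 / t`, hence at most a multiple of `min 1 w`. Only integrability of `min 1 w` is required,
so the lemma serves the Lévy measure and the probability law alike. -/
theorem hasDerivAt_integral_one_sub_exp {ν : Measure ℝ} (hν : ∀ᵐ w ∂ν, 0 ≤ w)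
    (hint : Integrable (fun w => min 1 w) ν) {t : ℝ} (ht : 0 < t) :
    Integrable (fun w => w * Real.exp (-(w * t))) ν ∧
      HasDerivAt (fun t => ∫ w, (1 - Real.exp (-(w * t))) ∂ν)
        (∫ w, w * Real.exp (-(w * t)) ∂ν) t := by
  refine hasDerivAt_integral_of_dominated_loc_of_deriv_le (s := Ioi (t / 2))
    (F := fun t w => 1 - Real.exp (-(w * t))) (F' := fun t w => w * Real.exp (-(w * t)))
    (bound := fun w => (1 + 2 / t) * min 1 w) (Ioi_mem_nhds (half_lt_self ht))
    (Eventually.of_forall fun x => by fun_prop) ?_ (by fun_prop) ?_ (hint.const_mul _) ?_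
  · refine Integrable.mono' (hint.const_mul (1 + t)) (by fun_prop) ?_
    filter_upwards [hν] with w hw
    have h0 : 0 ≤ w * t := by positivity
    have h1 : Real.exp (-(w * t)) ≤ 1 := Real.exp_le_one_iff.2 (by linarith)
    have h2 := Real.add_one_le_exp (-(w * t))
    rw [Real.norm_of_nonneg (by linarith)]
    rcases le_total 1 w with h | h
    · rw [min_eq_left h]; linarith [Real.exp_pos (-(w * t))]
    · rw [min_eq_right h]; nlinarith
  · filter_upwards [hν] with w hw x hx
    have hx' : t / 2 < x := hx
    rw [Real.norm_of_nonneg (by positivity)]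
    have h0 : 0 ≤ w * (t / 2) := by positivity
    have h1 : Real.exp (-(w * x)) ≤ Real.exp (-(w * (t / 2))) := by
      gcongr
    have h2 : Real.exp (-(w * (t / 2))) ≤ 1 := Real.exp_le_one_iff.2 (by linarith)
    have h3 : w * (t / 2) * Real.exp (-(w * (t / 2))) ≤ 1 := by
      have := Real.add_one_le_exp (w * (t / 2))
      rw [Real.exp_neg, ← div_eq_mul_inv, div_le_one (Real.exp_pos _)]
      linarith
    have h4 : w * Real.exp (-(w * x)) ≤ 2 / t := by
      calc w * Real.exp (-(w * x)) ≤ w * Real.exp (-(w * (t / 2))) := by gcongr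
        _ = 2 / t * (w * (t / 2) * Real.exp (-(w * (t / 2)))) := by field_simp
        _ ≤ 2 / t * 1 := by gcongr
        _ = 2 / t := mul_one _
    have h5 : w * Real.exp (-(w * x)) ≤ w := by
      nlinarith
    have h6 : 0 < 2 / t := by positivity
    rcases le_total 1 w with h | h
    · rw [min_eq_left h]; linarith
    · rw [min_eq_right h]; nlinarith
  · refine ae_of_all _ fun w x _ => ?_
    have h1 : HasDerivAt (fun x : ℝ => -(w * x)) (-w) x := by
      simpa using ((hasDerivAt_id x).const_mul w).fun_neg
    have h2 := (h1.exp).const_sub 1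
    convert h2 using 1
    ring

theorem IsLevyMeasure.ae_pos {ρ : Measure ℝ} (h : IsLevyMeasure ρ) : ∀ᵐ w ∂ρ, 0 < w := by
  have : ∀ᵐ w ∂ρ, w ∉ Iic (0 : ℝ) := measure_eq_zero_iff_ae_notMem.1 h.null_Iic
  filter_upwards [this] with w hw
  simpa using hw

theorem IsLevyMeasure.integrable {ρ : Measure ℝ} (h : IsLevyMeasure ρ) :
    Integrable (fun w => min 1 w) ρ :=
  integrable_min_one_of_lintegral (h.ae_pos.mono fun _ => le_of_lt) h.lintegral_lt_top

theorem IsInfDivLaw.ae_nonneg {a : ℝ} {η μ : Measure ℝ} (h : IsInfDivLaw a η μ) :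
    ∀ᵐ s ∂μ, 0 ≤ s := by
  have : ∀ᵐ s ∂μ, s ∉ Iio (0 : ℝ) := measure_eq_zero_iff_ae_notMem.1 h.nonneg
  filter_upwards [this] with s hs
  simpa using hs

theorem IsInfDivLaw.integrable_min {a : ℝ} {η μ : Measure ℝ} (h : IsInfDivLaw a η μ) :
    Integrable (fun w => min 1 w) μ := by
  have := h.prob
  refine Integrable.mono' (integrable_const (1 : ℝ)) (by fun_prop) ?_
  filter_upwards [h.ae_nonneg] with s hs
  rw [Real.norm_of_nonneg (le_min zero_le_one hs)]
  exact min_le_left _ _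

theorem integrable_exp_neg {μ : Measure ℝ} [IsFiniteMeasure μ] (h : ∀ᵐ s ∂μ, 0 ≤ s)
    {t : ℝ} (ht : 0 ≤ t) : Integrable (fun s => Real.exp (-(s * t))) μ := by
  refine Integrable.mono' (integrable_const (1 : ℝ)) (by fun_prop) ?_
  filter_upwards [h] with s hs
  rw [Real.norm_of_nonneg (Real.exp_pos _).le]
  exact Real.exp_le_one_iff.2 (by have := mul_nonneg hs ht; linarith)

/-- The derivative of the Laplace transform of an infinitely divisible law. -/
theorem IsInfDivLaw.integral_mul_exp {a : ℝ} {η μ : Measure ℝ} (hη : IsLevyMeasure η)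
    (h : IsInfDivLaw a η μ) {t : ℝ} (ht : 0 < t) :
    ∫ s, s * Real.exp (-(s * t)) ∂μ =
      (a + ∫ w, w * Real.exp (-(w * t)) ∂η) * ∫ s, Real.exp (-(s * t)) ∂μ := by
  have := h.prob
  have h1 := (hasDerivAt_integral_one_sub_exp h.ae_nonneg h.integrable_min ht).2
  have h2 := (hasDerivAt_integral_one_sub_exp (hη.ae_pos.mono fun _ => le_of_lt)
    hη.integrable ht).2
  have hL : ∀ t : ℝ, 0 ≤ t → ∫ s, Real.exp (-(s * t)) ∂μ =
      Real.exp (-(t * a) - ∫ w, (1 - Real.exp (-(w * t))) ∂η) := by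
    intro t ht
    rw [← h.laplace t ht]
    simp_rw [mul_comm t]
  -- The same function is differentiated twice: under the integral against `μ`, and by the chain
  -- rule through the Lévy exponent. Uniqueness of the derivative gives the identity.
  have h3 : HasDerivAt (fun t : ℝ => 1 - Real.exp (-(t * a) - ∫ w, (1 - Real.exp (-(w * t))) ∂η))
      (∫ s, s * Real.exp (-(s * t)) ∂μ) t := by
    refine h1.congr_of_eventuallyEq ?_
    filter_upwards [Ioi_mem_nhds ht] with r hr
    rw [← hL r (le_of_lt hr), integral_sub (integrable_const _)
      (integrable_exp_neg h.ae_nonneg (le_of_lt hr))]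
    simp
  have h4 : HasDerivAt (fun t : ℝ => -(t * a)) (-a) t := by
    simpa using ((hasDerivAt_id t).mul_const a).fun_neg
  have h5 := ((h4.fun_sub h2).exp).const_sub 1
  rw [h3.unique h5, hL t ht.le]
  ring

/-- Steutel's identity for infinitely divisible laws on `[0, ∞)`. -/
theorem IsInfDivLaw.lintegral_mul {a : ℝ} (ha : 0 ≤ a) {η μ : Measure ℝ} (hη : IsLevyMeasure η)
    (h : IsInfDivLaw a η μ) {f : ℝ → ENNReal} (hf : Measurable f) :
    ∫⁻ s, ENNReal.ofReal s * f s ∂μ = ENNReal.ofReal a * ∫⁻ s, f s ∂μ +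
      ∫⁻ s, ∫⁻ w, ENNReal.ofReal w * f (s + w) ∂η ∂μ := by
  have := h.prob
  have := hη.sigmaFinite
  have hη0 : ∀ᵐ w ∂η, 0 ≤ w := hη.ae_pos.mono fun _ => le_of_lt
  have hIμ : ∀ t : ℝ, 0 < t → Integrable (fun s => s * Real.exp (-(s * t))) μ := fun t ht =>
    (hasDerivAt_integral_one_sub_exp h.ae_nonneg h.integrable_min ht).1
  have hIη : ∀ t : ℝ, 0 < t → Integrable (fun s => s * Real.exp (-(s * t))) η := fun t ht =>
    (hasDerivAt_integral_one_sub_exp hη0 hη.integrable ht).1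
  have hIe : ∀ t : ℝ, 0 < t → Integrable (fun s => Real.exp (-(s * t))) μ := fun t ht =>
    integrable_exp_neg h.ae_nonneg ht.le
  -- Neither `s μ(ds)` nor `w η(dw)` need be finite. Tilting by `exp (-s)` makes all three measures
  -- finite and respects convolution, since the tilt is multiplicative.
  set α := μ.withDensity fun s => ENNReal.ofReal (s * Real.exp (-(s * 1))) with hα
  set μ₁ := μ.withDensity fun s => ENNReal.ofReal (Real.exp (-(s * 1))) with hμ₁
  set η₁ := η.withDensity fun s => ENNReal.ofReal (s * Real.exp (-(s * 1))) with hη₁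
  have : IsFiniteMeasure α := isFiniteMeasure_withDensity_ofReal (hIμ 1 one_pos).2
  have : IsFiniteMeasure μ₁ := isFiniteMeasure_withDensity_ofReal (hIe 1 one_pos).2
  have : IsFiniteMeasure η₁ := isFiniteMeasure_withDensity_ofReal (hIη 1 one_pos).2
  have lα : ∀ g : ℝ → ENNReal, Measurable g →
      ∫⁻ s, g s ∂α = ∫⁻ s, ENNReal.ofReal (s * Real.exp (-(s * 1))) * g s ∂μ := fun g hg =>
    lintegral_withDensity_eq_lintegral_mul _ (by fun_prop) hg
  have lμ : ∀ g : ℝ → ENNReal, Measurable g →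
      ∫⁻ s, g s ∂μ₁ = ∫⁻ s, ENNReal.ofReal (Real.exp (-(s * 1))) * g s ∂μ := fun g hg =>
    lintegral_withDensity_eq_lintegral_mul _ (by fun_prop) hg
  have lη : ∀ g : ℝ → ENNReal, Measurable g →
      ∫⁻ s, g s ∂η₁ = ∫⁻ s, ENNReal.ofReal (s * Real.exp (-(s * 1))) * g s ∂η := fun g hg =>
    lintegral_withDensity_eq_lintegral_mul _ (by fun_prop) hg
  have lβ : ∀ g : ℝ → ENNReal, Measurable g →
      ∫⁻ s, g s ∂(ENNReal.ofReal a • μ₁ + μ₁.conv η₁) =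
        ENNReal.ofReal a * ∫⁻ s, g s ∂μ₁ + ∫⁻ s, ∫⁻ w, g (s + w) ∂η₁ ∂μ₁ := fun g hg => by
    rw [lintegral_add_measure, lintegral_smul_measure, Measure.lintegral_conv hg, smul_eq_mul]
  have : IsFiniteMeasure (ENNReal.ofReal a • μ₁) := by
    refine ⟨?_⟩
    rw [Measure.smul_apply, smul_eq_mul]
    exact ENNReal.mul_lt_top ENNReal.ofReal_lt_top (measure_lt_top _ _)
  have key : α = ENNReal.ofReal a • μ₁ + μ₁.conv η₁ := by
    have hμ₁0 : ∀ᵐ s ∂μ₁, 0 ≤ s := (withDensity_absolutelyContinuous _ _).ae_le h.ae_nonneg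
    have hη₁0 : ∀ᵐ s ∂η₁, 0 ≤ s := (withDensity_absolutelyContinuous _ _).ae_le hη0
    refine Measure.ext_of_laplace_natCast ?_ ?_ fun n => ?_
    · exact (withDensity_absolutelyContinuous _ _) h.nonneg
    · have hi : ∀ γ : Measure ℝ, γ (Iio 0) = ∫⁻ s, (Iio (0 : ℝ)).indicator 1 s ∂γ := fun γ => by
        rw [lintegral_indicator_one measurableSet_Iio]
      rw [hi, lβ _ (measurable_one.indicator measurableSet_Iio)]
      have z1 : ∫⁻ s, (Iio (0 : ℝ)).indicator (1 : ℝ → ENNReal) s ∂μ₁ = 0 := by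
        rw [← hi]; exact (withDensity_absolutelyContinuous _ _) h.nonneg
      rw [z1, mul_zero, zero_add]
      rw [← lintegral_zero (μ := μ₁)]
      refine lintegral_congr_ae ?_
      filter_upwards [hμ₁0] with s hs
      rw [← lintegral_zero (μ := η₁)]
      refine lintegral_congr_ae ?_
      filter_upwards [hη₁0] with w hw
      rw [indicator_of_notMem]
      simp only [mem_Iio, not_lt]
      linarith
    -- The tilt shifts the Laplace variable by one, so only arguments `n + 1 > 0` occur, where the
    -- derivative identity is available.
    · have hn : (0 : ℝ) < n + 1 := by positivity
      have e1 : ∫⁻ s, ENNReal.ofReal (Real.exp (-(n * s))) ∂α =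
          ENNReal.ofReal (∫ s, s * Real.exp (-(s * (n + 1))) ∂μ) := by
        rw [lα _ (by fun_prop), ofReal_integral_eq_lintegral_ofReal (hIμ _ hn)]
        · refine lintegral_congr fun s => ?_
          rw [← ENNReal.ofReal_mul' (Real.exp_pos _).le, mul_assoc, ← Real.exp_add]
          ring_nf
        · filter_upwards [h.ae_nonneg] with s hs
          positivity
      have e2 : ∫⁻ s, ENNReal.ofReal (Real.exp (-(n * s))) ∂μ₁ =
          ENNReal.ofReal (∫ s, Real.exp (-(s * (n + 1))) ∂μ) := by
        rw [lμ _ (by fun_prop), ofReal_integral_eq_lintegral_ofReal (hIe _ hn)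
          (ae_of_all _ fun s => (Real.exp_pos _).le)]
        refine lintegral_congr fun s => ?_
        rw [← ENNReal.ofReal_mul' (Real.exp_pos _).le, ← Real.exp_add]
        ring_nf
      have e3 : ∫⁻ s, ENNReal.ofReal (Real.exp (-(n * s))) ∂η₁ =
          ENNReal.ofReal (∫ s, s * Real.exp (-(s * (n + 1))) ∂η) := by
        rw [lη _ (by fun_prop), ofReal_integral_eq_lintegral_ofReal (hIη _ hn)]
        · refine lintegral_congr fun s => ?_
          rw [← ENNReal.ofReal_mul' (Real.exp_pos _).le, mul_assoc, ← Real.exp_add]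
          ring_nf
        · filter_upwards [hη0] with s hs
          positivity
      have e4 : ∫⁻ s, ∫⁻ w, ENNReal.ofReal (Real.exp (-(n * (s + w)))) ∂η₁ ∂μ₁ =
          (∫⁻ s, ENNReal.ofReal (Real.exp (-(n * s))) ∂μ₁) *
            ∫⁻ s, ENNReal.ofReal (Real.exp (-(n * s))) ∂η₁ := by
        rw [← lintegral_mul_const _ (by fun_prop)]
        refine lintegral_congr fun s => ?_
        rw [← lintegral_const_mul _ (by fun_prop)]
        refine lintegral_congr fun w => ?_
        rw [← ENNReal.ofReal_mul (Real.exp_pos _).le, ← Real.exp_add]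
        ring_nf
      have p2 : 0 ≤ ∫ s, Real.exp (-(s * (n + 1))) ∂μ :=
        integral_nonneg fun s => (Real.exp_pos _).le
      have p3 : 0 ≤ ∫ s, s * Real.exp (-(s * (n + 1))) ∂η := by
        refine integral_nonneg_of_ae ?_
        filter_upwards [hη0] with s hs
        positivity
      rw [lβ _ (by fun_prop), e4, e1, e2, e3, h.integral_mul_exp hη hn, ← ENNReal.ofReal_mul ha,
        ← ENNReal.ofReal_mul p2, ← ENNReal.ofReal_add (by positivity) (by positivity)]
      congr 1
      ring
  -- Testing the tilted identity against `exp s * f s` removes the tilt.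
  have hg : Measurable fun s => ENNReal.ofReal (Real.exp s) * f s := by fun_prop
  have hexp : ∀ s : ℝ, ENNReal.ofReal (Real.exp (-(s * 1))) * ENNReal.ofReal (Real.exp s) = 1 := by
    intro s
    rw [← ENNReal.ofReal_mul (Real.exp_pos _).le, ← Real.exp_add]
    simp
  have e0 := lβ _ hg
  rw [← key, lα _ hg, lμ _ hg, lμ _ (by fun_prop)] at e0
  convert e0 using 1
  · refine lintegral_congr fun s => ?_
    rw [ENNReal.ofReal_mul' (Real.exp_pos _).le, mul_assoc, ← mul_assoc (ENNReal.ofReal _)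
      (ENNReal.ofReal _) (f s), hexp, one_mul]
  · congr 1
    · congr 1
      refine lintegral_congr fun s => ?_
      rw [← mul_assoc, hexp, one_mul]
    · refine lintegral_congr fun s => ?_
      rw [lη _ (by fun_prop), ← lintegral_const_mul _ (by fun_prop)]
      refine lintegral_congr fun w => ?_
      rw [ENNReal.ofReal_mul' (Real.exp_pos _).le, Real.exp_add s w,
        ENNReal.ofReal_mul (Real.exp_pos _).le]
      calc _ = 1 * ENNReal.ofReal w * 1 * f (s + w) := by ring
        _ = _ := by
          nth_rewrite 1 [← hexp s]
          rw [← hexp w]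
          ring

/-! ### Tails of infinitely divisible laws -/

/-- The kernel `w / (s + w)` on `{s + w > x}` in the tail form of Steutel's identity. -/
noncomputable def steutelKernel (x s w : ℝ) : ℝ := (Ioi x).indicator (fun r => w / r) (s + w)

theorem measurable_steutelKernel (x : ℝ) :
    Measurable fun p : ℝ × ℝ => steutelKernel x p.1 p.2 := by
  have h : (fun p : ℝ × ℝ => steutelKernel x p.1 p.2) =
      {p : ℝ × ℝ | x < p.1 + p.2}.indicator fun p => p.2 / (p.1 + p.2) := by
    ext p
    by_cases hp : x < p.1 + p.2 <;> simp [steutelKernel, indicator, hp]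
  rw [h]
  exact Measurable.indicator (by fun_prop) (measurableSet_lt (by fun_prop) (by fun_prop))

theorem steutelKernel_nonneg {x s w : ℝ} (hx : 0 < x) (hw : 0 ≤ w) : 0 ≤ steutelKernel x s w := by
  refine indicator_apply_nonneg fun hr => ?_
  exact div_nonneg hw (hx.trans hr).le

/-- On the support `s + w > x`, so `w / (s + w)` is below `w / x` as well as below `1`. Being
uniform in `s`, this bound controls the range of large `s`. -/
theorem steutelKernel_le_min {x s w : ℝ} (hx : 0 < x) (hs : 0 ≤ s) (hw : 0 ≤ w) :
    steutelKernel x s w ≤ min 1 (w / x) := by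
  by_cases hr : s + w ∈ Ioi x
  · rw [steutelKernel, indicator_of_mem hr]
    have hr' : x < s + w := hr
    refine le_min ?_ ?_
    · rw [div_le_one (hx.trans hr')]; linarith
    · gcongr
  · rw [steutelKernel, indicator_of_notMem hr]
    positivity

theorem steutelKernel_le_indicator {x s w : ℝ} (hx : 0 < x) (hs : 0 ≤ s) :
    steutelKernel x s w ≤ (Ioi (x - s)).indicator 1 w := by
  by_cases hr : x < s + w
  · rw [steutelKernel, indicator_of_mem (show s + w ∈ Ioi x from hr),
      indicator_of_mem (show w ∈ Ioi (x - s) by rw [mem_Ioi]; linarith), Pi.one_apply,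
      div_le_one (hx.trans hr)]
    linarith
  · rw [steutelKernel, indicator_of_notMem (show s + w ∉ Ioi x from hr)]
    exact indicator_nonneg (fun _ _ => zero_le_one) _

/-- For fixed `s ≥ 0` the ratio `w / (s + w)` increases with `w`, and equals `(x - s) / x` at the
edge `w = x - s`. -/
theorem indicator_le_steutelKernel {x s w : ℝ} (hx : 0 < x) (hs : 0 ≤ s) :
    (Ioi (x - s)).indicator (fun _ => (x - s) / x) w ≤ steutelKernel x s w := by
  by_cases hr : x < s + w
  · rw [steutelKernel, indicator_of_mem (show s + w ∈ Ioi x from hr),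
      indicator_of_mem (show w ∈ Ioi (x - s) by rw [mem_Ioi]; linarith),
      div_le_div_iff₀ hx (hx.trans hr)]
    nlinarith
  · rw [steutelKernel, indicator_of_notMem (show s + w ∉ Ioi x from hr),
      indicator_of_notMem (show w ∉ Ioi (x - s) by rw [mem_Ioi]; linarith)]

theorem min_one_div_le {w x : ℝ} (hx : 0 < x) (hw : 0 ≤ w) :
    min 1 (w / x) ≤ (1 + 1 / x) * min 1 w := by
  have h : 0 < 1 / x := by positivity
  rcases le_total 1 w with h1 | h1
  · rw [min_eq_left h1]
    exact (min_le_left _ _).trans (by linarith)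
  · rw [min_eq_right h1]
    refine (min_le_right _ _).trans ?_
    rw [div_eq_mul_one_div]
    nlinarith

namespace IsLevyMeasure

variable {η : Measure ℝ}

theorem measure_Ioi_lt_top (h : IsLevyMeasure η) {x : ℝ} (hx : 0 < x) : η (Ioi x) < ⊤ := by
  have hm : 0 < min 1 x := lt_min one_pos hx
  have h1 := meas_ge_le_lintegral_div (μ := η) (f := fun w => ENNReal.ofReal (min 1 w))
    (by fun_prop) (ε := ENNReal.ofReal (min 1 x)) (by simpa using hx) ENNReal.ofReal_ne_top
  refine (measure_mono fun w hw => ?_).trans_lt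
    (h1.trans_lt (ENNReal.div_lt_top h.lintegral_lt_top.ne (by simpa using hx)))
  exact ENNReal.ofReal_le_ofReal (min_le_min le_rfl (le_of_lt hw))

theorem integrable_min_div (h : IsLevyMeasure η) {x : ℝ} (hx : 0 < x) :
    Integrable (fun w => min 1 (w / x)) η := by
  refine Integrable.mono' (h.integrable.const_mul (1 + 1 / x)) (by fun_prop) ?_
  filter_upwards [h.ae_pos] with w hw
  rw [Real.norm_of_nonneg (by positivity)]
  exact min_one_div_le hx hw.le

theorem tendsto_integral_min_div (h : IsLevyMeasure η) :
    Tendsto (fun x => ∫ w, min 1 (w / x) ∂η) atTop (nhds 0) := by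
  rw [← integral_zero ℝ ℝ (μ := η)]
  refine tendsto_integral_filter_of_dominated_convergence (fun w => min 1 w)
    (Eventually.of_forall fun x => by fun_prop) ?_ h.integrable ?_
  · filter_upwards [eventually_ge_atTop 1] with x hx
    filter_upwards [h.ae_pos] with w hw
    rw [Real.norm_of_nonneg (by positivity)]
    exact min_le_min le_rfl (div_le_self hw.le hx)
  · filter_upwards [h.ae_pos] with w hw
    have h1 : Tendsto (fun x : ℝ => w / x) atTop (nhds 0) := tendsto_const_nhds.div_atTop tendsto_id
    simpa using tendsto_const_nhds (x := (1 : ℝ)).min h1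

theorem integrable_steutelKernel (h : IsLevyMeasure η) {x s : ℝ} (hx : 0 < x) (hs : 0 ≤ s) :
    Integrable (steutelKernel x s) η := by
  refine Integrable.mono' (h.integrable_min_div hx)
    ((measurable_steutelKernel x).comp measurable_prodMk_left).aestronglyMeasurable ?_
  filter_upwards [h.ae_pos] with w hw
  rw [Real.norm_of_nonneg (steutelKernel_nonneg hx hw.le)]
  exact steutelKernel_le_min hx hs hw.le

theorem integral_steutelKernel_nonneg (h : IsLevyMeasure η) {x s : ℝ} (hx : 0 < x) :
    0 ≤ ∫ w, steutelKernel x s w ∂η := by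
  refine integral_nonneg_of_ae ?_
  filter_upwards [h.ae_pos] with w hw using steutelKernel_nonneg hx hw.le

theorem integral_steutelKernel_le_min (h : IsLevyMeasure η) {x s : ℝ} (hx : 0 < x) (hs : 0 ≤ s) :
    ∫ w, steutelKernel x s w ∂η ≤ ∫ w, min 1 (w / x) ∂η := by
  refine integral_mono_ae (h.integrable_steutelKernel hx hs) (h.integrable_min_div hx) ?_
  filter_upwards [h.ae_pos] with w hw using steutelKernel_le_min hx hs hw.le

theorem integral_steutelKernel_le_tail (h : IsLevyMeasure η) {x s : ℝ} (hx : 0 < x) (hs : 0 ≤ s)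
    (hsx : s < x) : ∫ w, steutelKernel x s w ∂η ≤ η.real (Ioi (x - s)) := by
  rw [← integral_indicator_one measurableSet_Ioi]
  refine integral_mono (h.integrable_steutelKernel hx hs) ?_
    fun w => steutelKernel_le_indicator hx hs
  exact (integrable_indicator_iff measurableSet_Ioi).2
    (integrableOn_const (h.measure_Ioi_lt_top (sub_pos.2 hsx)).ne)

theorem tail_le_integral_steutelKernel (h : IsLevyMeasure η) {x s : ℝ} (hx : 0 < x) (hs : 0 ≤ s)
    (hsx : s < x) : (x - s) / x * η.real (Ioi (x - s)) ≤ ∫ w, steutelKernel x s w ∂η := by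
  have e : (x - s) / x * η.real (Ioi (x - s)) =
      ∫ w, (Ioi (x - s)).indicator (fun _ => (x - s) / x) w ∂η := by
    rw [integral_indicator_const _ measurableSet_Ioi, smul_eq_mul, mul_comm]
  rw [e]
  refine integral_mono ?_ (h.integrable_steutelKernel hx hs)
    fun w => indicator_le_steutelKernel hx hs
  exact (integrable_indicator_iff measurableSet_Ioi).2
    (integrableOn_const (h.measure_Ioi_lt_top (sub_pos.2 hsx)).ne)

/-- The integral lies between `(x - s) / x * η(x - s, ∞)` and `η(x - s, ∞)`, and a fixed shift `s`
does not affect a power tail. -/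
theorem tendsto_rpow_mul_integral_steutelKernel (h : IsLevyMeasure η) {c τ : ℝ}
    (hc : Tendsto (fun x => x ^ τ * η.real (Ioi x)) atTop (nhds c)) {s : ℝ} (hs : 0 ≤ s) :
    Tendsto (fun x => x ^ τ * ∫ w, steutelKernel x s w ∂η) atTop (nhds c) := by
  have hsub : Tendsto (fun x : ℝ => x - s) atTop atTop := tendsto_atTop_add_const_right _ _ tendsto_id
  have hratio : Tendsto (fun x : ℝ => (x - s) / x) atTop (nhds 1) := by
    have h1 : Tendsto (fun x : ℝ => 1 - s / x) atTop (nhds (1 - 0)) :=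
      tendsto_const_nhds.sub (tendsto_const_nhds.div_atTop tendsto_id)
    rw [sub_zero] at h1
    refine h1.congr' ?_
    filter_upwards [eventually_gt_atTop 0] with x hx
    field_simp
  have hup : Tendsto (fun x : ℝ => x ^ τ * η.real (Ioi (x - s))) atTop (nhds c) := by
    have h1 : Tendsto (fun x : ℝ => (((x - s) / x) ^ τ)⁻¹ * ((x - s) ^ τ * η.real (Ioi (x - s))))
        atTop (nhds ((1 ^ τ)⁻¹ * c)) :=
      ((hratio.rpow_const (Or.inl one_ne_zero)).inv₀ (by simp)).mul (hc.comp hsub)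
    rw [Real.one_rpow, inv_one, one_mul] at h1
    refine h1.congr' ?_
    filter_upwards [eventually_gt_atTop s] with x hx
    have hx0 : 0 < x := hs.trans_lt hx
    have hxs : 0 < x - s := sub_pos.2 hx
    rw [Real.div_rpow hxs.le hx0.le]
    have := (Real.rpow_pos_of_pos hxs τ).ne'
    have := (Real.rpow_pos_of_pos hx0 τ).ne'
    field_simp
  have hlow : Tendsto (fun x : ℝ => (x - s) / x * (x ^ τ * η.real (Ioi (x - s)))) atTop (nhds c) := by
    simpa using hratio.mul hup
  refine tendsto_of_tendsto_of_tendsto_of_le_of_le' hlow hup ?_ ?_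
  · filter_upwards [eventually_gt_atTop s] with x hx
    have hx0 : 0 < x := hs.trans_lt hx
    rw [mul_left_comm]
    exact mul_le_mul_of_nonneg_left (h.tail_le_integral_steutelKernel hx0 hs hx) (by positivity)
  · filter_upwards [eventually_gt_atTop s] with x hx
    have hx0 : 0 < x := hs.trans_lt hx
    exact mul_le_mul_of_nonneg_left (h.integral_steutelKernel_le_tail hx0 hs hx) (by positivity)

end IsLevyMeasure

namespace IsInfDivLaw

variable {a : ℝ} {η μ : Measure ℝ}

theorem integrable_integral_steutelKernel (hη : IsLevyMeasure η) (h : IsInfDivLaw a η μ) {x : ℝ}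
    (hx : 0 < x) : Integrable (fun s => ∫ w, steutelKernel x s w ∂η) μ := by
  have := h.prob
  have := hη.sigmaFinite
  refine Integrable.mono' (integrable_const (∫ w, min 1 (w / x) ∂η))
    (measurable_steutelKernel x).stronglyMeasurable.integral_prod_right.aestronglyMeasurable ?_
  filter_upwards [h.ae_nonneg] with s hs
  rw [Real.norm_of_nonneg (hη.integral_steutelKernel_nonneg hx)]
  exact hη.integral_steutelKernel_le_min hx hs

theorem integrableOn_inv (h : IsInfDivLaw a η μ) {x : ℝ} (hx : 0 < x) :
    IntegrableOn (fun s => s⁻¹) (Ioi x) μ := by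
  have := h.prob
  refine Integrable.mono' (integrable_const x⁻¹) (by fun_prop) ?_
  filter_upwards [ae_restrict_mem measurableSet_Ioi] with s hs
  have hs' : x < s := hs
  rw [Real.norm_of_nonneg (inv_nonneg.2 (hx.trans hs').le)]
  gcongr

theorem tail_eq (ha : 0 ≤ a) (hη : IsLevyMeasure η) (h : IsInfDivLaw a η μ) {x : ℝ} (hx : 0 < x) :
    μ.real (Ioi x) = a * ∫ s in Ioi x, s⁻¹ ∂μ + ∫ s, ∫ w, steutelKernel x s w ∂η ∂μ := by
  have := h.prob
  have := hη.sigmaFinite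
  -- Steutel's identity is tested on `1 / s` restricted to `(x, ∞)`, which cancels the weight `s`
  -- and leaves the tail of `μ` on the left.
  have hf : Measurable ((Ioi x).indicator fun s : ℝ => ENNReal.ofReal s⁻¹) :=
    Measurable.indicator (by fun_prop) measurableSet_Ioi
  have key := h.lintegral_mul ha hη hf
  have e1 : ∫⁻ s, ENNReal.ofReal s * (Ioi x).indicator (fun s : ℝ => ENNReal.ofReal s⁻¹) s ∂μ =
      μ (Ioi x) := by
    rw [← lintegral_indicator_one measurableSet_Ioi]
    refine lintegral_congr fun s => ?_
    by_cases hs : s ∈ Ioi x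
    · have hs0 : 0 < s := hx.trans hs
      rw [indicator_of_mem hs, indicator_of_mem hs, ← ENNReal.ofReal_mul hs0.le,
        mul_inv_cancel₀ hs0.ne', ENNReal.ofReal_one, Pi.one_apply]
    · rw [indicator_of_notMem hs, indicator_of_notMem hs, mul_zero]
  have e2 : ∫⁻ s, (Ioi x).indicator (fun s : ℝ => ENNReal.ofReal s⁻¹) s ∂μ =
      ENNReal.ofReal (∫ s in Ioi x, s⁻¹ ∂μ) := by
    rw [lintegral_indicator measurableSet_Ioi,
      ofReal_integral_eq_lintegral_ofReal (h.integrableOn_inv hx)]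
    filter_upwards [ae_restrict_mem measurableSet_Ioi] with s hs
    exact inv_nonneg.2 (hx.trans hs).le
  have e3 : ∫⁻ s, ∫⁻ w, ENNReal.ofReal w *
      (Ioi x).indicator (fun s : ℝ => ENNReal.ofReal s⁻¹) (s + w) ∂η ∂μ =
      ENNReal.ofReal (∫ s, ∫ w, steutelKernel x s w ∂η ∂μ) := by
    rw [ofReal_integral_eq_lintegral_ofReal (h.integrable_integral_steutelKernel hη hx)
      (ae_of_all _ fun s => hη.integral_steutelKernel_nonneg hx)]
    refine lintegral_congr_ae ?_
    filter_upwards [h.ae_nonneg] with s hs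
    rw [ofReal_integral_eq_lintegral_ofReal (hη.integrable_steutelKernel hx hs)]
    · refine lintegral_congr_ae ?_
      filter_upwards [hη.ae_pos] with w hw
      by_cases hr : s + w ∈ Ioi x
      · rw [steutelKernel, indicator_of_mem hr, indicator_of_mem hr, ← ENNReal.ofReal_mul hw.le,
          div_eq_mul_inv]
      · rw [steutelKernel, indicator_of_notMem hr, indicator_of_notMem hr, mul_zero,
          ENNReal.ofReal_zero]
    · filter_upwards [hη.ae_pos] with w hw using steutelKernel_nonneg hx hw.le
  have p2 : 0 ≤ ∫ s in Ioi x, s⁻¹ ∂μ := by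
    refine setIntegral_nonneg measurableSet_Ioi fun s hs => inv_nonneg.2 (hx.trans hs).le
  have p3 : 0 ≤ ∫ s, ∫ w, steutelKernel x s w ∂η ∂μ :=
    integral_nonneg fun s => hη.integral_steutelKernel_nonneg hx
  rw [e1, e2, e3, ← ENNReal.ofReal_mul ha, ← ENNReal.ofReal_add (by positivity) p3] at key
  rw [Measure.real, key, ENNReal.toReal_ofReal (by positivity)]

theorem integral_Ioi_inv_le (h : IsInfDivLaw a η μ) {x : ℝ} (hx : 0 < x) :
    ∫ s in Ioi x, s⁻¹ ∂μ ≤ x⁻¹ * μ.real (Ioi x) := by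
  have := h.prob
  calc ∫ s in Ioi x, s⁻¹ ∂μ ≤ ∫ _ in Ioi x, x⁻¹ ∂μ := by
        refine setIntegral_mono_on (h.integrableOn_inv hx) (integrable_const _).integrableOn
          measurableSet_Ioi fun s hs => ?_
        have hs' : x < s := hs
        gcongr
    _ = x⁻¹ * μ.real (Ioi x) := by
        rw [setIntegral_const, smul_eq_mul, mul_comm]

/-- Dominated convergence in `s`. The cut `s ≤ x / 2` keeps `x - s ≥ x / 2`, so the integrand stays
below `2 ^ τ * (c + 1)` for large `x`. -/
theorem tendsto_rpow_mul_setIntegral (hη : IsLevyMeasure η) (h : IsInfDivLaw a η μ) {c τ : ℝ}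
    (hc : Tendsto (fun x => x ^ τ * η.real (Ioi x)) atTop (nhds c)) :
    Tendsto (fun x => x ^ τ * ∫ s in Iic (x / 2), ∫ w, steutelKernel x s w ∂η ∂μ) atTop
      (nhds c) := by
  have := h.prob
  have := hη.sigmaFinite
  have hhalf : Tendsto (fun x : ℝ => x / 2) atTop atTop := tendsto_id.atTop_div_const two_pos
  have e : ∀ x : ℝ, x ^ τ * ∫ s in Iic (x / 2), ∫ w, steutelKernel x s w ∂η ∂μ =
      ∫ s, (Iic (x / 2)).indicator (fun s => x ^ τ * ∫ w, steutelKernel x s w ∂η) s ∂μ := by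
    intro x
    rw [integral_indicator measurableSet_Iic, integral_const_mul]
  simp_rw [e]
  have hlim : c = ∫ _, c ∂μ := by simp
  rw [hlim]
  refine tendsto_integral_filter_of_dominated_convergence (fun _ => 2 ^ τ * (c + 1)) ?_ ?_
    (integrable_const _) ?_
  · refine Eventually.of_forall fun x => AEStronglyMeasurable.indicator ?_ measurableSet_Iic
    exact ((measurable_steutelKernel x).stronglyMeasurable.integral_prod_right.const_mul
      _).aestronglyMeasurable
  · filter_upwards [eventually_gt_atTop 0, hhalf.eventually (hc.eventually_le_const
      (lt_add_one c))] with x hx hcx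
    have hx2 : 0 < x / 2 := by positivity
    have hB : x ^ τ * η.real (Ioi (x / 2)) ≤ 2 ^ τ * (c + 1) := by
      calc x ^ τ * η.real (Ioi (x / 2)) = 2 ^ τ * ((x / 2) ^ τ * η.real (Ioi (x / 2))) := by
            rw [← mul_assoc, ← Real.mul_rpow zero_le_two hx2.le, mul_div_cancel₀ _ two_ne_zero]
        _ ≤ _ := by gcongr
    filter_upwards [h.ae_nonneg] with s hs
    by_cases hsx : s ∈ Iic (x / 2)
    · have hsx' : s ≤ x / 2 := hsx
      rw [indicator_of_mem hsx, Real.norm_of_nonneg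
        (mul_nonneg (by positivity) (hη.integral_steutelKernel_nonneg hx))]
      refine le_trans (mul_le_mul_of_nonneg_left ?_ (by positivity)) hB
      refine (hη.integral_steutelKernel_le_tail hx hs (by linarith)).trans ?_
      exact measureReal_mono (Ioi_subset_Ioi (by linarith)) (hη.measure_Ioi_lt_top hx2).ne
    · rw [indicator_of_notMem hsx, norm_zero]
      exact le_trans (mul_nonneg (by positivity) measureReal_nonneg) hB
  · filter_upwards [h.ae_nonneg] with s hs
    refine (hη.tendsto_rpow_mul_integral_steutelKernel hc hs).congr' ?_
    filter_upwards [hhalf.eventually_ge_atTop s] with x hx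
    rw [indicator_of_mem (show s ∈ Iic (x / 2) from hx)]

/-- The tail of an infinitely divisible law on `[0, ∞)` is equivalent to that of its Lévy
measure, if the latter is of power type. -/
theorem tendsto_rpow_mul_tail (ha : 0 ≤ a) (hη : IsLevyMeasure η) (h : IsInfDivLaw a η μ) {c τ : ℝ}
    (hτ : 0 < τ) (hc : Tendsto (fun x => x ^ τ * η.real (Ioi x)) atTop (nhds c)) :
    Tendsto (fun x => x ^ τ * μ.real (Ioi x)) atTop (nhds c) := by
  have := h.prob
  have hM := h.tendsto_rpow_mul_setIntegral hη hc
  have hκ := hη.tendsto_integral_min_div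
  set M := fun x => x ^ τ * ∫ s in Iic (x / 2), ∫ w, steutelKernel x s w ∂η ∂μ with hMdef
  set κ := fun x => ∫ w, min 1 (w / x) ∂η with hκdef
  set q := fun x => x ^ τ * μ.real (Ioi x) with hq
  have hκ0 : ∀ x, 0 < x → 0 ≤ κ x := fun x hx => by
    refine integral_nonneg_of_ae ?_
    filter_upwards [hη.ae_pos] with w hw
    positivity
  have hq0 : ∀ x, 0 < x → 0 ≤ q x := fun x hx => by positivity
  have hsplit : ∀ x, 0 < x → q x = a * (x ^ τ * ∫ s in Ioi x, s⁻¹ ∂μ) + M x +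
      x ^ τ * ∫ s in Ioi (x / 2), ∫ w, steutelKernel x s w ∂η ∂μ := by
    intro x hx
    have h1 := integral_add_compl (measurableSet_Iic (a := x / 2))
      (h.integrable_integral_steutelKernel hη hx)
    rw [compl_Iic] at h1
    simp only [hq, hMdef]
    rw [h.tail_eq ha hη hx, ← h1]
    ring
  -- The range `s > x / 2` costs the normalised tail at `x / 2`, but with a coefficient `κ x` that
  -- tends to `0`.
  have hfar : ∀ x, 0 < x → x ^ τ * ∫ s in Ioi (x / 2), ∫ w, steutelKernel x s w ∂η ∂μ ≤
      2 ^ τ * κ x * q (x / 2) := by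
    intro x hx
    have h1 : ∫ s in Ioi (x / 2), ∫ w, steutelKernel x s w ∂η ∂μ ≤ κ x * μ.real (Ioi (x / 2)) := by
      calc _ ≤ ∫ _ in Ioi (x / 2), κ x ∂μ := by
            refine setIntegral_mono_on (h.integrable_integral_steutelKernel hη hx).integrableOn
              (integrable_const _).integrableOn measurableSet_Ioi fun s hs => ?_
            have hs' : x / 2 < s := hs
            exact hη.integral_steutelKernel_le_min hx (by linarith)
        _ = _ := by rw [setIntegral_const, smul_eq_mul, mul_comm]
    calc _ ≤ x ^ τ * (κ x * μ.real (Ioi (x / 2))) := by gcongr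
      _ = _ := by
        have e : x ^ τ = 2 ^ τ * (x / 2) ^ τ := by
          rw [← Real.mul_rpow zero_le_two (by positivity), mul_div_cancel₀ _ two_ne_zero]
        simp only [hq]
        rw [e]
        ring
  have hfar0 : ∀ x, 0 < x → 0 ≤ x ^ τ * ∫ s in Ioi (x / 2), ∫ w, steutelKernel x s w ∂η ∂μ :=
    fun x hx => mul_nonneg (by positivity)
      (integral_nonneg fun s => hη.integral_steutelKernel_nonneg hx)
  have hinv : ∀ x, 0 < x → a * (x ^ τ * ∫ s in Ioi x, s⁻¹ ∂μ) ≤ a / x * q x := by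
    intro x hx
    calc _ ≤ a * (x ^ τ * (x⁻¹ * μ.real (Ioi x))) := by
          have := h.integral_Ioi_inv_le hx
          gcongr
      _ = _ := by simp only [hq]; ring
  have hinv0 : ∀ x, 0 < x → 0 ≤ a * (x ^ τ * ∫ s in Ioi x, s⁻¹ ∂μ) := fun x hx =>
    mul_nonneg ha (mul_nonneg (by positivity)
      (setIntegral_nonneg measurableSet_Ioi fun s hs => inv_nonneg.2 (hx.trans hs).le))
  have hax : Tendsto (fun x => a / x) atTop (nhds 0) := tendsto_const_nhds.div_atTop tendsto_id
  have h2κ : Tendsto (fun x => 2 ^ τ * κ x) atTop (nhds 0) := by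
    simpa using hκ.const_mul (2 ^ τ)
  -- Boundedness of `q` makes both error terms vanish. Beyond `x₀` one has `q x ≤ 2 (c + 1) + q (x /
  -- 2) / 2`, which preserves any bound `B ≥ 4 (c + 1)`; up to `x₀` the trivial bound is `x₀ ^ τ`.
  -- Induction on dyadic ranges then covers all `x`.
  obtain ⟨B, hB⟩ : ∃ B, ∀ x, 0 < x → q x ≤ B := by
    obtain ⟨x₀, hx₀⟩ := eventually_atTop.1 ((((hM.eventually_le_const (lt_add_one c)).and
      (hax.eventually_le_const (show (0 : ℝ) < 1 / 2 by norm_num))).and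
      (h2κ.eventually_le_const (show (0 : ℝ) < 1 / 4 by norm_num))).and (eventually_gt_atTop 0))
    have hx₀pos : 0 < x₀ := (hx₀ x₀ le_rfl).2
    have hstep : ∀ x, x₀ ≤ x → q x ≤ 2 * (c + 1) + q (x / 2) / 2 := by
      intro x hx
      obtain ⟨⟨⟨h1, h2⟩, h3⟩, h4⟩ := hx₀ x hx
      have h5 := hsplit x h4
      have h6 := hfar x h4
      have h7 := hinv x h4
      have h8 := mul_le_mul_of_nonneg_right h2 (hq0 x h4)
      have h9 := mul_le_mul_of_nonneg_right h3 (hq0 (x / 2) (by positivity))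
      linarith
    refine ⟨max (4 * (c + 1)) (x₀ ^ τ), ?_⟩
    set B := max (4 * (c + 1)) (x₀ ^ τ) with hBdef
    have hsmall : ∀ x, 0 < x → x ≤ x₀ → q x ≤ B := by
      intro x hx hxx
      calc q x ≤ x₀ ^ τ * 1 := by
            simp only [hq]
            gcongr
            exact measureReal_le_one
        _ ≤ B := by rw [mul_one]; exact le_max_right _ _
    have hind : ∀ n : ℕ, ∀ x, 0 < x → x ≤ 2 ^ n * x₀ → q x ≤ B := by
      intro n
      induction n with
      | zero => intro x hx hxx; exact hsmall x hx (by simpa using hxx)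
      | succ n ih =>
        intro x hx hxx
        rcases le_total x x₀ with h0 | h0
        · exact hsmall x hx h0
        · have h1 := hstep x h0
          have h2 := ih (x / 2) (by positivity) (by rw [pow_succ] at hxx; linarith)
          have h3 : 4 * (c + 1) ≤ B := le_max_left _ _
          linarith
    intro x hx
    obtain ⟨n, hn⟩ := pow_unbounded_of_one_lt (x / x₀) (one_lt_two (α := ℝ))
    exact hind n x hx (by rw [div_lt_iff₀ hx₀pos] at hn; exact hn.le)
  have hup : Tendsto (fun x => a / x * B + M x + 2 ^ τ * κ x * B) atTop (nhds c) := by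
    simpa using ((hax.mul_const B).add hM).add (h2κ.mul_const B)
  refine tendsto_of_tendsto_of_tendsto_of_le_of_le' hM hup ?_ ?_
  · filter_upwards [eventually_gt_atTop 0] with x hx
    linarith [hsplit x hx, hfar0 x hx, hinv0 x hx]
  · filter_upwards [eventually_gt_atTop 0] with x hx
    have h1 := mul_le_mul_of_nonneg_left (hB x hx) (show 0 ≤ a / x by positivity)
    have h2 := mul_le_mul_of_nonneg_left (hB (x / 2) (by positivity))
      (mul_nonneg (show (0 : ℝ) ≤ 2 ^ τ by positivity) (hκ0 x hx))
    linarith [hsplit x hx, hfar x hx, hinv x hx]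

end IsInfDivLaw

/-! ### Log-power tails and Breiman's lemma -/

/-- `F x ~ K x ^ (-τ) (log x) ^ m` as `x → ∞`, in a form that allows `K = 0`. -/
def HasLogPowerTail (F : ℝ → ℝ) (τ : ℝ) (m : ℕ) (K : ℝ) : Prop :=
  Tendsto (fun x => F x * x ^ τ / Real.log x ^ m) atTop (nhds K)

theorem tendsto_log_div_const_div_log {k : ℝ} (hk : 0 < k) :
    Tendsto (fun x => Real.log (x / k) / Real.log x) atTop (nhds 1) := by
  have h1 : Tendsto (fun x => 1 - Real.log k / Real.log x) atTop (nhds (1 - 0)) :=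
    tendsto_const_nhds.sub (tendsto_const_nhds.div_atTop Real.tendsto_log_atTop)
  rw [sub_zero] at h1
  refine h1.congr' ?_
  filter_upwards [eventually_gt_atTop 1] with x hx
  have := (Real.log_pos hx).ne'
  rw [Real.log_div (by positivity) hk.ne']
  field_simp

theorem measurable_measureReal_Ioi (ν : Measure ℝ) : Measurable fun x => ν.real (Ioi x) :=
  (Antitone.measurable fun _ _ h => measure_mono (Ioi_subset_Ioi h)).ennreal_toReal

namespace HasLogPowerTail

variable {F G : ℝ → ℝ} {τ K : ℝ} {m : ℕ}

theorem congr' (h : HasLogPowerTail F τ m K) (hFG : F =ᶠ[atTop] G) : HasLogPowerTail G τ m K := by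
  refine Tendsto.congr' ?_ h
  filter_upwards [hFG] with x hx
  rw [hx]

theorem comp_div (h : HasLogPowerTail F τ m K) {k : ℝ} (hk : 0 < k) :
    HasLogPowerTail (fun x => F (x / k)) τ m (K * k ^ τ) := by
  have hdiv : Tendsto (fun x : ℝ => x / k) atTop atTop := tendsto_id.atTop_div_const hk
  have h1 := ((h.comp hdiv).mul_const (k ^ τ)).mul ((tendsto_log_div_const_div_log hk).pow m)
  rw [one_pow, mul_one] at h1
  refine h1.congr' ?_
  filter_upwards [eventually_gt_atTop 1, hdiv.eventually_gt_atTop 1] with x hx hxk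
  have h2 := (Real.log_pos hx).ne'
  have h3 := (Real.log_pos hxk).ne'
  have h4 : 0 < k ^ τ := Real.rpow_pos_of_pos hk _
  simp only [Function.comp_apply]
  rw [Real.div_rpow (by positivity) hk.le, div_pow]
  field_simp

theorem le_of_nonneg (h : HasLogPowerTail F τ m K) (hF : ∀ x, 0 < x → 0 ≤ F x) : 0 ≤ K := by
  refine ge_of_tendsto h ?_
  filter_upwards [eventually_gt_atTop 1] with x hx
  have := Real.log_pos hx
  have := hF x (by positivity)
  positivity

/-- Breiman's lemma. -/
theorem integral_comp_div {α : Type*} [MeasurableSpace α] {ν : Measure α} [IsFiniteMeasure ν]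
    (h : HasLogPowerTail F τ m K) {W : α → ℝ} (hW : Measurable W) (hW0 : ∀ᵐ z ∂ν, 0 ≤ W z)
    (hFm : Measurable F) (hFa : AntitoneOn F (Ioi 0)) (hF0 : ∀ x, 0 < x → 0 ≤ F x)
    {p C : ℝ} (hτ : 0 < τ) (hp : τ ≤ p) (hC : ∀ y, 0 < y → y ≤ 1 → F y ≤ C * y ^ (-p))
    (hint : Integrable (fun z => W z ^ p) ν) :
    HasLogPowerTail (fun x => ∫ z in {z | 0 < W z}, F (x / W z) ∂ν) τ m
      (K * ∫ z, W z ^ τ ∂ν) := by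
  have hs : MeasurableSet {z | 0 < W z} := measurableSet_lt measurable_const hW
  have hp0 : 0 < p := hτ.trans_le hp
  have hK := h.le_of_nonneg hF0
  have hC0 : 0 ≤ C := by
    have := (hF0 1 one_pos).trans (hC 1 one_pos le_rfl)
    simpa using this
  -- Beyond `y₀` the normalised `F` is at most `K + 1`; taking `y₀ ≥ e` makes the logarithms at
  -- least `1`, so powers of them can be dropped from denominators.
  obtain ⟨y₀, hy₀⟩ := eventually_atTop.1 ((h.eventually_le_const (lt_add_one K)).and
    (eventually_ge_atTop (Real.exp 1)))
  have hy₀e : Real.exp 1 ≤ y₀ := (hy₀ y₀ le_rfl).2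
  have hy₀1 : 1 ≤ y₀ := le_trans (by linarith [Real.add_one_le_exp (1 : ℝ)]) hy₀e
  have hy₀p : 0 < y₀ := by positivity
  have hlog : ∀ y, y₀ ≤ y → 1 ≤ Real.log y := fun y hy => by
    rw [Real.le_log_iff_exp_le (by linarith)]; linarith
  have hsmall : ∀ y, 0 < y → y ≤ y₀ → F y ≤ C * y₀ ^ p * y ^ (-p) := by
    intro y hy hyy
    have h1 : 1 ≤ y₀ ^ p := Real.one_le_rpow hy₀1 hp0.le
    rcases le_total y 1 with hy1 | hy1
    · refine (hC y hy hy1).trans ?_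
      have : 0 ≤ y ^ (-p) := by positivity
      gcongr
      exact le_mul_of_one_le_right hC0 h1
    · have h2 : F y ≤ C := by
        have h3 := hC 1 one_pos le_rfl
        rw [Real.one_rpow, mul_one] at h3
        exact (hFa (mem_Ioi.2 one_pos) hy hy1).trans h3
      have h4 : 1 ≤ y₀ ^ p * y ^ (-p) := by
        rw [Real.rpow_neg hy.le, ← div_eq_mul_inv, one_le_div (by positivity)]
        gcongr
      rw [mul_assoc]
      exact h2.trans (le_mul_of_one_le_right hC0 h4)
  have e : ∀ x, (∫ z in {z | 0 < W z}, F (x / W z) ∂ν) * x ^ τ / Real.log x ^ m =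
      ∫ z, {z | 0 < W z}.indicator (fun z => F (x / W z) * x ^ τ / Real.log x ^ m) z ∂ν := by
    intro x
    rw [integral_indicator hs, integral_div, integral_mul_const]
  unfold HasLogPowerTail
  simp_rw [e]
  rw [← integral_const_mul]
  -- The dominating function covers three cases. If `W ≤ 1`, monotonicity gives `K + 1`. If `W ≥ 1`
  -- and `x / W ≥ y₀`, the asymptotics at `x / W` give `(K + 1) W ^ p`. If `x / W ≤ y₀`, the bound
  -- `C y₀ ^ p (x / W) ^ (-p)` and `x ^ τ ≤ x ^ p` give the last term. The hypothesis on small `y`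
  -- admits an `F` that blows up at `0`, as Lévy tails may.
  refine tendsto_integral_filter_of_dominated_convergence
    (fun z => (K + 1) * (1 + W z ^ p) + C * y₀ ^ p * W z ^ p) ?_ ?_ ?_ ?_
  · refine Eventually.of_forall fun x => (Measurable.indicator ?_ hs).aestronglyMeasurable
    fun_prop
  · filter_upwards [eventually_ge_atTop y₀] with x hx
    have hx1 : 1 ≤ x := hy₀1.trans hx
    have hxp : 0 < x := by positivity
    have hlx := hlog x hx
    have hlx0 : 0 < Real.log x := by linarith
    have hxτ : 0 < x ^ τ := Real.rpow_pos_of_pos hxp _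
    filter_upwards [hW0] with z hz
    by_cases hw : 0 < W z
    · rw [indicator_of_mem (show z ∈ {z | 0 < W z} from hw)]
      have hF := hF0 (x / W z) (by positivity)
      rw [Real.norm_of_nonneg (by positivity)]
      have hwp : 0 < W z ^ p := Real.rpow_pos_of_pos hw _
      have hCp : 0 ≤ C * y₀ ^ p * W z ^ p := by positivity
      rcases le_total (W z) 1 with hw1 | hw1
      · have h1 : F (x / W z) ≤ F x := hFa hxp (mem_Ioi.2 (by positivity))
          (by rw [le_div_iff₀ hw]; nlinarith)
        calc F (x / W z) * x ^ τ / Real.log x ^ m ≤ F x * x ^ τ / Real.log x ^ m := by gcongr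
          _ ≤ K + 1 := (hy₀ x hx).1
          _ ≤ _ := by nlinarith
      · rcases le_total y₀ (x / W z) with hy | hy
        · have h1 := (hy₀ _ hy).1
          have h2 := hlog _ hy
          have h3 : Real.log (x / W z) ≤ Real.log x :=
            Real.log_le_log (by positivity) (div_le_self hxp.le hw1)
          have h4 : F (x / W z) * x ^ τ / Real.log x ^ m ≤
              F (x / W z) * (x / W z) ^ τ / Real.log (x / W z) ^ m * W z ^ τ := by
            have h5 : F (x / W z) * (x / W z) ^ τ / Real.log (x / W z) ^ m * W z ^ τ =
                F (x / W z) * x ^ τ / Real.log (x / W z) ^ m := by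
              have := (Real.rpow_pos_of_pos hw τ).ne'
              rw [Real.div_rpow hxp.le hw.le]
              field_simp
            rw [h5]
            gcongr
          have h6 : W z ^ τ ≤ W z ^ p := Real.rpow_le_rpow_of_exponent_le hw1 hp
          calc _ ≤ _ := h4
            _ ≤ (K + 1) * W z ^ p := by gcongr
            _ ≤ _ := by nlinarith
        · have h1 := hsmall _ (by positivity) hy
          have h2 : x ^ τ ≤ x ^ p := Real.rpow_le_rpow_of_exponent_le hx1 hp
          have h3 : (1 : ℝ) ≤ Real.log x ^ m := one_le_pow₀ hlx
          calc F (x / W z) * x ^ τ / Real.log x ^ m ≤ F (x / W z) * x ^ τ :=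
                div_le_self (by positivity) h3
            _ ≤ C * y₀ ^ p * (x / W z) ^ (-p) * x ^ p := by gcongr
            _ = C * y₀ ^ p * W z ^ p := by
                rw [Real.rpow_neg (by positivity), Real.div_rpow hxp.le hw.le]
                have := (Real.rpow_pos_of_pos hxp p).ne'
                field_simp
            _ ≤ _ := by nlinarith
    · rw [indicator_of_notMem (show z ∉ {z | 0 < W z} from hw), norm_zero]
      positivity
  · exact (((integrable_const _).add hint).const_mul _).add (hint.const_mul _)
  · filter_upwards [hW0] with z hz
    rcases hz.eq_or_lt with hw | hw
    · rw [← hw, Real.zero_rpow hτ.ne', mul_zero]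
      refine tendsto_const_nhds.congr fun x => ?_
      rw [indicator_of_notMem (show z ∉ {z | 0 < W z} by simp [← hw])]
    · have h1 := h.comp_div hw
      refine Tendsto.congr (fun x => ?_) h1
      rw [indicator_of_mem (show z ∈ {z | 0 < W z} from hw)]

end HasLogPowerTail

/-! ### Truncated moments and products with equal tail index -/

/-- The comparison function `log ^ m t / t` has primitive `L = log ^ (m + 1) / (m + 1)`, which
diverges; so asymptotic equivalence of the integrands passes to the integrals, and the part before
any fixed `x₀` is absorbed. -/
theorem tendsto_integral_div_log_pow {h : ℝ → ℝ} {m : ℕ} {K : ℝ}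
    (hint : ∀ x, IntervalIntegrable h volume 0 x)
    (hlim : Tendsto (fun t => h t * t / Real.log t ^ m) atTop (nhds K)) :
    Tendsto (fun x => (∫ t in (0 : ℝ)..x, h t) / Real.log x ^ (m + 1)) atTop
      (nhds (K / (m + 1))) := by
  set L : ℝ → ℝ := fun x => Real.log x ^ (m + 1) / (m + 1) with hL
  have hm : (0 : ℝ) < m + 1 := by positivity
  have hLtop : Tendsto L atTop atTop :=
    ((tendsto_pow_atTop m.succ_ne_zero).comp Real.tendsto_log_atTop).atTop_div_const hm
  have hder : ∀ t : ℝ, 0 < t → HasDerivAt L (Real.log t ^ m / t) t := by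
    intro t ht
    have := ((Real.hasDerivAt_log ht.ne').fun_pow (m + 1)).div_const ((m : ℝ) + 1)
    refine this.congr_deriv ?_
    push_cast
    field_simp
  have hgi : ∀ x y : ℝ, 0 < x → x ≤ y →
      IntervalIntegrable (fun t => Real.log t ^ m / t) volume x y := by
    intro x y hx hxy
    refine ContinuousOn.intervalIntegrable ?_
    rw [uIcc_of_le hxy]
    refine ContinuousOn.div ((Real.continuousOn_log.mono ?_).pow m) continuousOn_id ?_
    · intro t ht; exact (hx.trans_le ht.1).ne'
    · intro t ht; exact (hx.trans_le ht.1).ne'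
  have hgint : ∀ x y : ℝ, 0 < x → x ≤ y → ∫ t in x..y, Real.log t ^ m / t = L y - L x := by
    intro x y hx hxy
    refine intervalIntegral.integral_eq_sub_of_hasDerivAt (fun t ht => ?_) (hgi x y hx hxy)
    rw [uIcc_of_le hxy] at ht
    exact hder t (hx.trans_le ht.1)
  have hsmall : (fun x => (∫ t in (0 : ℝ)..x, h t) - K * L x) =o[atTop] L := by
    refine Asymptotics.isLittleO_iff.2 fun δ hδ => ?_
    have hδ2 : 0 < δ / 2 := by positivity
    obtain ⟨x₀, hx₀⟩ := eventually_atTop.1 ((Metric.tendsto_nhds.1 hlim (δ / 2) hδ2).and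
      (eventually_gt_atTop 1))
    have hx₀1 : 1 < x₀ := (hx₀ x₀ le_rfl).2
    have hx₀p : 0 < x₀ := by positivity
    have hbound : ∀ t, x₀ ≤ t →
        |h t - K * (Real.log t ^ m / t)| ≤ δ / 2 * (Real.log t ^ m / t) := by
      intro t ht
      obtain ⟨h1, h2⟩ := hx₀ t ht
      have hl := Real.log_pos h2
      have htp : 0 < t := by positivity
      have hg : 0 < Real.log t ^ m / t := by positivity
      rw [Real.dist_eq] at h1
      have e : h t - K * (Real.log t ^ m / t) =
          (h t * t / Real.log t ^ m - K) * (Real.log t ^ m / t) := by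
        field_simp
      rw [e, abs_mul, abs_of_pos hg]
      gcongr
    have hLnn : ∀ x, 1 < x → 0 ≤ L x := fun x hx => by
      have := Real.log_pos hx
      positivity
    set D := |(∫ t in (0 : ℝ)..x₀, h t) - K * L x₀| with hD
    filter_upwards [eventually_ge_atTop x₀, hLtop.eventually_ge_atTop (D / (δ / 2))] with x hx hx2
    have hDL : D ≤ δ / 2 * L x := by
      rw [div_le_iff₀ hδ2] at hx2
      linarith
    have hhi : IntervalIntegrable h volume x₀ x := (hint x₀).symm.trans (hint x)
    have h3 : |∫ t in x₀..x, (h t - K * (Real.log t ^ m / t))| ≤ δ / 2 * L x := by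
      have h4 : ‖∫ t in x₀..x, (h t - K * (Real.log t ^ m / t))‖ ≤
          ∫ t in x₀..x, δ / 2 * (Real.log t ^ m / t) := by
        refine intervalIntegral.norm_integral_le_of_norm_le hx
          (ae_of_all _ fun t ht => hbound t ht.1.le) ((hgi x₀ x hx₀p hx).const_mul _)
      rw [intervalIntegral.integral_const_mul, hgint x₀ x hx₀p hx] at h4
      refine h4.trans ?_
      have := hLnn x₀ hx₀1
      gcongr
      linarith
    rw [intervalIntegral.integral_sub hhi ((hgi x₀ x hx₀p hx).const_mul _),
      intervalIntegral.integral_const_mul, hgint x₀ x hx₀p hx] at h3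
    have h5 := intervalIntegral.integral_add_adjacent_intervals (hint x₀) hhi
    rw [Real.norm_eq_abs, Real.norm_of_nonneg (hLnn x (hx₀1.trans_le hx)), ← h5]
    calc _ = |((∫ t in (0 : ℝ)..x₀, h t) - K * L x₀) +
          ((∫ t in x₀..x, h t) - K * (L x - L x₀))| := by congr 1; ring
      _ ≤ D + δ / 2 * L x := (abs_add_le _ _).trans (by gcongr)
      _ ≤ δ * L x := by linarith
  have h6 := (hsmall.tendsto_div_nhds_zero.add_const K).div_const ((m : ℝ) + 1)
  rw [zero_add] at h6
  refine h6.congr' ?_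
  filter_upwards [eventually_gt_atTop 1] with x hx
  have := (Real.log_pos hx).ne'
  simp only [hL]
  field_simp
  ring

theorem integrable_min_rpow {ν : Measure ℝ} [IsFiniteMeasure ν] (hν : ∀ᵐ y ∂ν, 0 ≤ y) {τ x : ℝ}
    (hτ : 0 < τ) (hx : 0 ≤ x) : Integrable (fun y => (min y x) ^ τ) ν := by
  refine Integrable.mono' (integrable_const (x ^ τ))
    (Measurable.aestronglyMeasurable (by fun_prop)) ?_
  filter_upwards [hν] with y hy
  have : 0 ≤ min y x := le_min hy hx
  rw [Real.norm_of_nonneg (by positivity)]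
  exact Real.rpow_le_rpow this (min_le_right _ _) hτ.le

theorem intervalIntegrable_rpow_mul_tail {ν : Measure ℝ} [IsFiniteMeasure ν] {τ : ℝ} (hτ : 0 < τ)
    (x : ℝ) : IntervalIntegrable (fun t => ν.real (Ioi t) * t ^ (τ - 1)) volume 0 x := by
  have h1 : IntervalIntegrable (fun t : ℝ => ν.real univ * t ^ (τ - 1)) volume 0 x :=
    (intervalIntegral.intervalIntegrable_rpow' (by linarith)).const_mul _
  refine h1.mono_fun ?_ (ae_of_all _ fun t => ?_)
  · have := measurable_measureReal_Ioi ν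
    exact Measurable.aestronglyMeasurable (by fun_prop)
  · beta_reduce
    rw [norm_mul, norm_mul, Real.norm_of_nonneg measureReal_nonneg,
      Real.norm_of_nonneg measureReal_nonneg]
    gcongr
    · exact measure_ne_top _ _
    · exact subset_univ _

theorem integral_min_rpow {ν : Measure ℝ} [IsFiniteMeasure ν] (hν : ∀ᵐ y ∂ν, 0 ≤ y) {τ x : ℝ}
    (hτ : 0 < τ) (hx : 0 ≤ x) :
    ∫ y, (min y x) ^ τ ∂ν = τ * ∫ t in (0 : ℝ)..x, ν.real (Ioi t) * t ^ (τ - 1) := by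
  have h0 : ∀ᵐ y ∂ν, 0 ≤ min y x := hν.mono fun y hy => le_min hy hx
  have key := lintegral_rpow_eq_lintegral_meas_lt_mul ν (f := fun y => min y x) h0
    (by fun_prop) hτ
  have hi := (intervalIntegrable_iff_integrableOn_Ioc_of_le hx).1
    (intervalIntegrable_rpow_mul_tail (ν := ν) hτ x)
  have hnn : 0 ≤ ∫ t in (0 : ℝ)..x, ν.real (Ioi t) * t ^ (τ - 1) :=
    intervalIntegral.integral_nonneg hx fun t ht =>
      mul_nonneg measureReal_nonneg (Real.rpow_nonneg ht.1 _)
  have e1 : ∫⁻ t in Ioi 0, ν {a | t < min a x} * ENNReal.ofReal (t ^ (τ - 1)) =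
      ENNReal.ofReal (∫ t in (0 : ℝ)..x, ν.real (Ioi t) * t ^ (τ - 1)) := by
    rw [intervalIntegral.integral_of_le hx, integral_Ioc_eq_integral_Ioo,
      ofReal_integral_eq_lintegral_ofReal (hi.mono_set Ioo_subset_Ioc_self)]
    · rw [← lintegral_indicator measurableSet_Ioi, ← lintegral_indicator measurableSet_Ioo]
      refine lintegral_congr fun t => ?_
      by_cases ht : 0 < t
      · rw [indicator_of_mem (show t ∈ Ioi 0 from ht)]
        by_cases htx : t < x
        · rw [indicator_of_mem (show t ∈ Ioo 0 x from ⟨ht, htx⟩),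
            ENNReal.ofReal_mul measureReal_nonneg, ofReal_measureReal]
          congr 2
          ext y
          simp [htx]
        · rw [indicator_of_notMem (fun h => htx h.2)]
          have : {a | t < min a x} = ∅ := by
            ext y
            simp [not_lt.1 htx]
          rw [this, measure_empty, zero_mul]
      · rw [indicator_of_notMem (show t ∉ Ioi 0 from ht), indicator_of_notMem fun h => ht h.1]
    · filter_upwards [ae_restrict_mem measurableSet_Ioo] with t ht
      exact mul_nonneg measureReal_nonneg (Real.rpow_nonneg ht.1.le _)
  rw [integral_eq_lintegral_of_nonneg_ae (h0.mono fun y hy => Real.rpow_nonneg hy _)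
    (Measurable.aestronglyMeasurable (by fun_prop)), key, e1,
    ← ENNReal.ofReal_mul hτ.le, ENNReal.toReal_ofReal (by positivity)]

/-- This is where the extra logarithm and the factor `τ / (m + 1)` arise: by the layer-cake formula
the truncated moment integrates `K log ^ m t / t`. -/
theorem HasLogPowerTail.tendsto_integral_min_rpow {ν : Measure ℝ} [IsFiniteMeasure ν]
    (hν : ∀ᵐ y ∂ν, 0 ≤ y) {τ K : ℝ} {m : ℕ} (hτ : 0 < τ)
    (h : HasLogPowerTail (fun x => ν.real (Ioi x)) τ m K) :
    Tendsto (fun x => (∫ y, (min y x) ^ τ ∂ν) / Real.log x ^ (m + 1)) atTop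
      (nhds (τ * (K / (m + 1)))) := by
  have h1 : Tendsto (fun t => ν.real (Ioi t) * t ^ (τ - 1) * t / Real.log t ^ m) atTop (nhds K) := by
    refine Tendsto.congr' ?_ h
    filter_upwards [eventually_gt_atTop 0] with t ht
    rw [mul_assoc (ν.real _) (t ^ (τ - 1)), ← Real.rpow_add_one ht.ne', sub_add_cancel]
  have h2 := (tendsto_integral_div_log_pow (intervalIntegrable_rpow_mul_tail hτ) h1).const_mul τ
  refine h2.congr' ?_
  filter_upwards [eventually_ge_atTop 0] with x hx
  rw [integral_min_rpow hν hτ hx, mul_div_assoc]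

/-- The tail of a product of independent nonnegative variables, one with a pure power tail and the
other with the same index and a power of the logarithm. -/
theorem HasLogPowerTail.mul {F : ℝ → ℝ} {c : ℝ} {ν : Measure ℝ} [IsFiniteMeasure ν]
    (hν : ∀ᵐ y ∂ν, 0 ≤ y) {τ K : ℝ} {m : ℕ} (hτ : 0 < τ) (hFm : Measurable F)
    (hF0 : ∀ x, 0 ≤ F x) (hF1 : ∀ x, F x ≤ 1) (hF : HasLogPowerTail F τ 0 c)
    (h : HasLogPowerTail (fun x => ν.real (Ioi x)) τ m K) :
    HasLogPowerTail (fun x => ∫ y in Ioi 0, F (x / y) ∂ν) τ (m + 1)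
      (c * (τ * (K / (m + 1)))) := by
  have hT := h.tendsto_integral_min_rpow hν hτ
  set T : ℝ → ℝ := fun x => ∫ y, (min y x) ^ τ ∂ν with hTdef
  set κ := τ * (K / (m + 1)) with hκ
  replace hT : Tendsto (fun x => T x / Real.log x ^ (m + 1)) atTop (nhds κ) := hT
  set N : ℝ → ℝ := fun x => ∫ y in Ioi 0, F (x / y) ∂ν with hN
  have hK : 0 ≤ K := h.le_of_nonneg fun x _ => measureReal_nonneg
  have hκ0 : 0 ≤ κ := by positivity
  have hFi : ∀ x, IntegrableOn (fun y => F (x / y)) (Ioi 0) ν := fun x => by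
    refine Integrable.mono' (integrable_const (1 : ℝ))
      (Measurable.aestronglyMeasurable (by fun_prop)) (ae_of_all _ fun y => ?_)
    rw [Real.norm_of_nonneg (hF0 _)]
    exact hF1 _
  have hset : ∀ g : ℝ → ℝ, g 0 = 0 → ∫ y in Ioi 0, g y ∂ν = ∫ y, g y ∂ν := by
    intro g hg
    refine setIntegral_eq_integral_of_ae_compl_eq_zero ?_
    filter_upwards [hν] with y hy hy0
    rw [le_antisymm (not_lt.1 hy0) hy, hg]
  -- The tail of `ν` has one logarithm fewer than the product, so everything with `y > x / A` is
  -- negligible.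
  have htail : ∀ A : ℝ, 0 < A → Tendsto (fun x => ν.real (Ioi (x / A)) * x ^ τ /
      Real.log x ^ (m + 1)) atTop (nhds 0) := by
    intro A hA
    have h1 := (h.comp_div hA).div_atTop Real.tendsto_log_atTop
    refine h1.congr fun x => ?_
    rw [pow_succ, div_div]
  have hcut : ∀ δ : ℝ, 0 < δ → ∃ A : ℝ, 1 ≤ A ∧ ∀ y, A ≤ y →
      (c - δ) * y ^ (-τ) ≤ F y ∧ F y ≤ (c + δ) * y ^ (-τ) := by
    intro δ hδ
    obtain ⟨A, hA⟩ := eventually_atTop.1 ((hF.eventually_const_le (sub_lt_self c hδ)).and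
      ((hF.eventually_le_const (lt_add_of_pos_right c hδ))))
    refine ⟨max A 1, le_max_right _ _, fun y hy => ?_⟩
    have hy0 : 0 < y := one_pos.trans_le ((le_max_right _ _).trans hy)
    have h1 := hA y ((le_max_left _ _).trans hy)
    rw [pow_zero, div_one] at h1
    have h2 : 0 < y ^ τ := Real.rpow_pos_of_pos hy0 _
    rw [Real.rpow_neg hy0.le, ← div_eq_mul_inv, ← div_eq_mul_inv, div_le_iff₀ h2, le_div_iff₀ h2]
    exact h1
  have hpow : ∀ x y : ℝ, 0 < x → 0 < y → (x / y) ^ (-τ) = x ^ (-τ) * y ^ τ := by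
    intro x y hx hy
    rw [Real.div_rpow hx.le hy.le, Real.rpow_neg hy.le, div_inv_eq_mul]
  have hc0 : 0 ≤ c := hF.le_of_nonneg fun x _ => hF0 x
  -- For `y ≤ x / A` the argument `x / y` is at least `A`, where `F` is within `δ` of its power law;
  -- for `y > x / A` only `F ≤ 1` is used.
  have hupper : ∀ δ A : ℝ, 0 < δ → 1 ≤ A → (∀ y, A ≤ y → F y ≤ (c + δ) * y ^ (-τ)) →
      ∀ x, 0 < x → N x ≤ (c + δ) * x ^ (-τ) * T x + ν.real (Ioi (x / A)) := by
    intro δ A hδ hA hFA x hx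
    have hA0 : 0 < A := by positivity
    have hi1 := (integrable_min_rpow hν hτ hx.le).const_mul ((c + δ) * x ^ (-τ))
    have hi2 : Integrable ((Ioi (x / A)).indicator (1 : ℝ → ℝ)) ν :=
      (integrable_const (1 : ℝ)).indicator measurableSet_Ioi
    have e : (c + δ) * x ^ (-τ) * T x + ν.real (Ioi (x / A)) =
        ∫ y in Ioi 0, ((c + δ) * x ^ (-τ) * (min y x) ^ τ + (Ioi (x / A)).indicator 1 y) ∂ν := by
      rw [hset, integral_add hi1 hi2, integral_const_mul, integral_indicator_one measurableSet_Ioi]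
      rw [min_eq_left hx.le, Real.zero_rpow hτ.ne', indicator_of_notMem]
      · simp
      · rw [mem_Ioi, not_lt]; positivity
    rw [e]
    refine setIntegral_mono_on (hFi x) (hi1.add hi2).integrableOn measurableSet_Ioi fun y hy => ?_
    have hy0 : 0 < y := hy
    have hmin : 0 < min y x := lt_min hy0 hx
    by_cases hyA : y ∈ Ioi (x / A)
    · rw [indicator_of_mem hyA, Pi.one_apply]
      have : 0 ≤ (c + δ) * x ^ (-τ) * (min y x) ^ τ := by positivity
      linarith [hF1 (x / y)]
    · rw [indicator_of_notMem hyA, add_zero]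
      have hyA' : y ≤ x / A := not_lt.1 hyA
      have h1 : A ≤ x / y := by
        rw [le_div_iff₀ hA0] at hyA'
        rw [le_div_iff₀ hy0]; linarith
      rw [min_eq_left (hyA'.trans (div_le_self hx.le hA)), mul_assoc, ← hpow x y hx hy0]
      exact hFA _ h1
  -- The bracket is the integral of `y ^ τ` over `y ≤ x / A`: the truncated moment minus the
  -- contribution of the values cut at `x / A`.
  have hlower : ∀ δ A : ℝ, 0 < δ → 1 ≤ A → (∀ y, A ≤ y → (c - δ) * y ^ (-τ) ≤ F y) →
      ∀ x, 0 < x →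
        (c - δ) * x ^ (-τ) * (T (x / A) - (x / A) ^ τ * ν.real (Ioi (x / A))) ≤ N x := by
    intro δ A hδ hA hFA x hx
    have hA0 : 0 < A := by positivity
    have hxA : 0 < x / A := by positivity
    have hi1 := integrable_min_rpow hν hτ hxA.le
    have hi2 : Integrable ((Ioi (x / A)).indicator fun _ : ℝ => (x / A) ^ τ) ν :=
      (integrable_const _).indicator measurableSet_Ioi
    have e : (c - δ) * x ^ (-τ) * (T (x / A) - (x / A) ^ τ * ν.real (Ioi (x / A))) =
        ∫ y in Ioi 0, (c - δ) * x ^ (-τ) *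
          ((min y (x / A)) ^ τ - (Ioi (x / A)).indicator (fun _ => (x / A) ^ τ) y) ∂ν := by
      rw [hset, integral_const_mul, integral_sub hi1 hi2,
        integral_indicator_const _ measurableSet_Ioi, smul_eq_mul, mul_comm (ν.real _)]
      rw [min_eq_left hxA.le, Real.zero_rpow hτ.ne', indicator_of_notMem]
      · simp
      · rw [mem_Ioi, not_lt]; positivity
    rw [e]
    refine setIntegral_mono_on ((hi1.sub hi2).const_mul _).integrableOn (hFi x)
      measurableSet_Ioi fun y hy => ?_
    have hy0 : 0 < y := hy
    by_cases hyA : y ∈ Ioi (x / A)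
    · rw [indicator_of_mem hyA, min_eq_right (le_of_lt hyA), sub_self, mul_zero]
      exact hF0 _
    · rw [indicator_of_notMem hyA, sub_zero]
      have hyA' : y ≤ x / A := not_lt.1 hyA
      have h1 : A ≤ x / y := by
        rw [le_div_iff₀ hA0] at hyA'
        rw [le_div_iff₀ hy0]; linarith
      rw [min_eq_left hyA', mul_assoc, ← hpow x y hx hy0]
      exact hFA _ h1
  refine tendsto_order.2 ⟨fun b hb => ?_, fun b hb => ?_⟩
  · obtain ⟨δ, hδ, hδb⟩ : ∃ δ : ℝ, 0 < δ ∧ b < (c - δ) * κ := by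
      -- This `δ` uses at most half of the gap between `b` and `c * κ`; the `+ 1` allows `κ = 0`.
      refine ⟨(c * κ - b) / (2 * (κ + 1)), div_pos (by linarith) (by positivity), ?_⟩
      have : (c * κ - b) / (2 * (κ + 1)) * κ ≤ (c * κ - b) / 2 := by
        rw [div_mul_eq_mul_div, div_le_div_iff₀ (by positivity) two_pos]
        nlinarith
      linarith
    obtain ⟨A, hA, hFA⟩ := hcut δ hδ
    have hA0 : 0 < A := by positivity
    have hdiv : Tendsto (fun x : ℝ => x / A) atTop atTop := tendsto_id.atTop_div_const hA0
    have h1 := ((hT.comp hdiv).mul ((tendsto_log_div_const_div_log hA0).pow (m + 1))).sub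
      ((htail A hA0).mul_const ((A ^ τ)⁻¹))
    have h2 := h1.const_mul (c - δ)
    rw [one_pow, mul_one, zero_mul, sub_zero] at h2
    filter_upwards [h2.eventually_const_lt hδb, eventually_gt_atTop 1, hdiv.eventually_gt_atTop 1]
      with x hx hx1 hxA
    refine hx.trans_le ?_
    have hx0 : 0 < x := by positivity
    have hl := Real.log_pos hx1
    have hlA := Real.log_pos hxA
    have hxτ : 0 < x ^ τ := Real.rpow_pos_of_pos hx0 _
    have hAτ : 0 < A ^ τ := Real.rpow_pos_of_pos hA0 _
    rw [le_div_iff₀ (by positivity)]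
    have h3 := mul_le_mul_of_nonneg_right
      (hlower δ A hδ hA (fun y hy => (hFA y hy).1) x hx0) hxτ.le
    refine le_trans (le_of_eq ?_) h3
    simp only [Function.comp_apply]
    rw [Real.rpow_neg hx0.le, Real.div_rpow hx0.le hA0.le, div_pow]
    field_simp
  · obtain ⟨δ, hδ, hδb⟩ : ∃ δ : ℝ, 0 < δ ∧ (c + δ) * κ < b := by
      refine ⟨(b - c * κ) / (2 * (κ + 1)), div_pos (by linarith) (by positivity), ?_⟩
      have : (b - c * κ) / (2 * (κ + 1)) * κ ≤ (b - c * κ) / 2 := by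
        rw [div_mul_eq_mul_div, div_le_div_iff₀ (by positivity) two_pos]
        nlinarith
      linarith
    obtain ⟨A, hA, hFA⟩ := hcut δ hδ
    have hA0 : 0 < A := by positivity
    have h2 := (hT.const_mul (c + δ)).add (htail A hA0)
    rw [add_zero] at h2
    filter_upwards [h2.eventually_lt_const hδb, eventually_gt_atTop 1] with x hx hx1
    refine lt_of_le_of_lt ?_ hx
    have hx0 : 0 < x := by positivity
    have hl := Real.log_pos hx1
    have hxτ : 0 < x ^ τ := Real.rpow_pos_of_pos hx0 _
    rw [div_le_iff₀ (by positivity)]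
    have h3 := mul_le_mul_of_nonneg_right
      (hupper δ A hδ hA (fun y hy => (hFA y hy).2) x hx0) hxτ.le
    refine le_trans h3 (le_of_eq ?_)
    rw [Real.rpow_neg hx0.le]
    field_simp

/-! ### Gaussian moments and the tail of one ReLU layer -/

theorem setIntegral_Ioi_rpow_gaussianReal {τ : ℝ} (hτ : 0 < τ) :
    ∫ z in Ioi 0, (z ^ 2) ^ τ ∂(gaussianReal 0 1) =
      2 ^ (τ - 1) * Real.Gamma (τ + 1 / 2) / √Real.pi := by
  rw [← integral_indicator measurableSet_Ioi, integral_gaussianReal_eq_integral_smul one_ne_zero]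
  have e : ∀ z : ℝ, gaussianPDFReal 0 1 z • (Ioi (0 : ℝ)).indicator (fun z => (z ^ 2) ^ τ) z =
      (Ioi (0 : ℝ)).indicator (fun z => (√(2 * Real.pi))⁻¹ *
        (z ^ (2 * τ) * Real.exp (-(1 / 2) * z ^ (2 : ℝ)))) z := by
    intro z
    by_cases hz : z ∈ Ioi (0 : ℝ)
    · have hz0 : 0 < z := hz
      rw [indicator_of_mem hz, indicator_of_mem hz, gaussianPDFReal, smul_eq_mul,
        Real.rpow_mul hz0.le, Real.rpow_two]
      simp only [NNReal.coe_one, mul_one, sub_zero]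
      ring_nf
    · rw [indicator_of_notMem hz, indicator_of_notMem hz, smul_zero]
  simp_rw [e]
  rw [integral_indicator measurableSet_Ioi, integral_const_mul,
    integral_rpow_mul_exp_neg_mul_rpow two_pos (by linarith) (by norm_num)]
  have e1 : (2 * τ + 1) / 2 = τ + 1 / 2 := by ring
  have e2 : -(2 * τ + 1) / 2 = -(τ + 1 / 2) := by ring
  have e3 : (1 / 2 : ℝ) ^ (-(τ + 1 / 2)) = 2 ^ (τ - 1) * (2 * √2) := by
    rw [one_div, Real.inv_rpow zero_le_two, Real.rpow_neg zero_le_two, inv_inv,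
      Real.sqrt_eq_rpow]
    nth_rewrite 4 [← Real.rpow_one 2]
    rw [← Real.rpow_add two_pos, ← Real.rpow_add two_pos]
    ring_nf
  rw [e1, e2, e3, Real.sqrt_mul zero_le_two]
  have : √2 ≠ 0 := by positivity
  have : √Real.pi ≠ 0 := by positivity
  field_simp

theorem integral_sq_rpow_gaussianReal {τ : ℝ} (hτ : 0 < τ) :
    ∫ z, (z ^ 2) ^ τ ∂(gaussianReal 0 1) = 2 ^ τ * Real.Gamma (τ + 1 / 2) / √Real.pi := by
  have h1 := setIntegral_Ioi_rpow_gaussianReal hτ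
  rw [← integral_indicator measurableSet_Ioi,
    integral_gaussianReal_eq_integral_smul one_ne_zero] at h1
  rw [integral_gaussianReal_eq_integral_smul one_ne_zero]
  have e : ∀ z : ℝ, gaussianPDFReal 0 1 z • (z ^ 2) ^ τ =
      (fun z => gaussianPDFReal 0 1 z • (z ^ 2) ^ τ) |z| := by
    intro z
    simp [gaussianPDFReal]
  rw [integral_congr_ae (ae_of_all _ e),
    integral_comp_abs (f := fun z => gaussianPDFReal 0 1 z • (z ^ 2) ^ τ),
    ← integral_indicator measurableSet_Ioi]
  have e1 : ∀ z : ℝ, (Ioi (0 : ℝ)).indicator (fun z => gaussianPDFReal 0 1 z • (z ^ 2) ^ τ) z =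
      gaussianPDFReal 0 1 z • (Ioi (0 : ℝ)).indicator (fun z => (z ^ 2) ^ τ) z := fun z => by
    rw [indicator_smul]
  simp_rw [e1]
  rw [h1, Real.rpow_sub_one two_ne_zero]
  ring

theorem integrable_sq_rpow_gaussianReal {p : ℝ} (hp : 0 < p) :
    Integrable (fun z : ℝ => (z ^ 2) ^ p) (gaussianReal 0 1) := by
  have h := (memLp_id_gaussianReal (μ := 0) (v := 1) (2 * p).toNNReal).integrable_norm_rpow'
  refine h.congr (ae_of_all _ fun z => ?_)
  have e : (z ^ 2) ^ p = |z| ^ (2 * p) := by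
    rw [Real.rpow_mul (abs_nonneg z), Real.rpow_two, sq_abs]
  beta_reduce
  rw [e, ENNReal.coe_toReal, Real.coe_toNNReal _ (by positivity), id, Real.norm_eq_abs]

theorem measurable_relu : Measurable relu := by
  unfold relu
  fun_prop

theorem relu_sq_le (z : ℝ) : relu z ^ 2 ≤ z ^ 2 := by
  rcases le_total z 0 with h | h
  · rw [relu, max_eq_right h, zero_pow two_ne_zero]; exact sq_nonneg z
  · rw [relu, max_eq_left h]

theorem integrable_relu_sq_rpow_gaussianReal {p : ℝ} (hp : 0 < p) :
    Integrable (fun z : ℝ => (relu z ^ 2) ^ p) (gaussianReal 0 1) := by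
  have := measurable_relu
  refine Integrable.mono' (integrable_sq_rpow_gaussianReal hp)
    (Measurable.aestronglyMeasurable (by fun_prop)) (ae_of_all _ fun z => ?_)
  rw [Real.norm_of_nonneg (by positivity)]
  exact Real.rpow_le_rpow (by positivity) (relu_sq_le z) hp.le

theorem integral_relu_sq_rpow_gaussianReal {τ : ℝ} (hτ : 0 < τ) :
    ∫ z, (relu z ^ 2) ^ τ ∂(gaussianReal 0 1) =
      2 ^ (τ - 1) * Real.Gamma (τ + 1 / 2) / √Real.pi := by
  rw [← setIntegral_Ioi_rpow_gaussianReal hτ, ← integral_indicator measurableSet_Ioi]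
  congr 1
  ext z
  by_cases hz : z ∈ Ioi (0 : ℝ)
  · rw [indicator_of_mem hz, relu, max_eq_left (le_of_lt hz)]
  · rw [indicator_of_notMem hz, relu, max_eq_right (not_lt.1 hz), zero_pow two_ne_zero,
      Real.zero_rpow hτ.ne']

/-- The bound `min 1 (w relu(z)²) ≤ min 1 w * (1 + z²)` separates the variables, and the Gaussian
has a second moment. -/
theorem IsLevyMeasure.activationLevy_relu {ρ : Measure ℝ} (h : IsLevyMeasure ρ) :
    IsLevyMeasure (activationLevy relu ρ) := by
  have := h.sigmaFinite
  have hr := measurable_relu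
  refine ⟨?_, ?_⟩
  · rw [activationLevy, Measure.restrict_apply measurableSet_Iic, Iic_inter_Ioi, Ioc_self,
      measure_empty]
  · have hb : ∀ p : ℝ × ℝ, ENNReal.ofReal (min 1 (p.1 * relu p.2 ^ 2)) ≤
        ENNReal.ofReal (min 1 p.1) * ENNReal.ofReal (1 + (p.2 ^ 2) ^ (1 : ℝ)) := by
      rintro ⟨w, z⟩
      rcases le_or_gt w 0 with hw | hw
      · rw [ENNReal.ofReal_of_nonpos ((min_le_right _ _).trans
          (mul_nonpos_of_nonpos_of_nonneg hw (by positivity)))]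
        exact zero_le
      · rw [← ENNReal.ofReal_mul (by positivity)]
        refine ENNReal.ofReal_le_ofReal ?_
        have hz := relu_sq_le z
        rw [Real.rpow_one]
        rcases le_total 1 w with h1 | h1
        · rw [min_eq_left h1]
          exact (min_le_left _ _).trans (by nlinarith)
        · rw [min_eq_right h1]
          exact (min_le_right _ _).trans (by nlinarith)
    have hi : Integrable (fun z : ℝ => 1 + (z ^ 2) ^ (1 : ℝ)) (gaussianReal 0 1) :=
      (integrable_const _).add (integrable_sq_rpow_gaussianReal one_pos)
    calc ∫⁻ w, ENNReal.ofReal (min 1 w) ∂(activationLevy relu ρ)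
        ≤ ∫⁻ w, ENNReal.ofReal (min 1 w)
            ∂((ρ.prod (gaussianReal 0 1)).map fun p : ℝ × ℝ => p.1 * relu p.2 ^ 2) :=
          setLIntegral_le_lintegral _ _
      _ = ∫⁻ p, ENNReal.ofReal (min 1 (p.1 * relu p.2 ^ 2)) ∂(ρ.prod (gaussianReal 0 1)) :=
          lintegral_map (by fun_prop) (by fun_prop)
      _ ≤ ∫⁻ p, ENNReal.ofReal (min 1 p.1) * ENNReal.ofReal (1 + (p.2 ^ 2) ^ (1 : ℝ))
            ∂(ρ.prod (gaussianReal 0 1)) := lintegral_mono hb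
      _ = (∫⁻ w, ENNReal.ofReal (min 1 w) ∂ρ) *
            ∫⁻ z, ENNReal.ofReal (1 + (z ^ 2) ^ (1 : ℝ)) ∂(gaussianReal 0 1) :=
          lintegral_prod_mul (f := fun w => ENNReal.ofReal (min 1 w))
            (g := fun z => ENNReal.ofReal (1 + (z ^ 2) ^ (1 : ℝ)))
            (Measurable.aemeasurable (by fun_prop)) (Measurable.aemeasurable (by fun_prop))
      _ < ⊤ := ENNReal.mul_lt_top h.lintegral_lt_top hi.lintegral_lt_top

/-- Markov's inequality for `min 1 w`; it supplies the control near `0` that Breiman's lemma asks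
for. -/
theorem IsLevyMeasure.tail_le {ρ : Measure ℝ} (h : IsLevyMeasure ρ) {y : ℝ} (hy : 0 < y)
    (hy1 : y ≤ 1) : ρ.real (Ioi y) ≤ (∫ w, min 1 w ∂ρ) * y⁻¹ := by
  rw [← div_eq_mul_inv, le_div_iff₀ hy, ← smul_eq_mul,
    ← integral_indicator_const _ measurableSet_Ioi]
  refine integral_mono_ae ?_ h.integrable ?_
  · exact (integrable_indicator_iff measurableSet_Ioi).2
      (integrableOn_const (h.measure_Ioi_lt_top hy).ne)
  · filter_upwards [h.ae_pos] with w hw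
    by_cases hwy : w ∈ Ioi y
    · rw [indicator_of_mem hwy]
      exact le_min hy1 (le_of_lt hwy)
    · rw [indicator_of_notMem hwy]
      positivity

theorem levyTail_activationLevy_relu {ρ : Measure ℝ} (h : IsLevyMeasure ρ) {x : ℝ} (hx : 0 < x) :
    (activationLevy relu ρ).real (Ioi x) =
      ∫ z in {z | 0 < relu z ^ 2}, levyTail ρ (x / relu z ^ 2) ∂(gaussianReal 0 1) := by
  have hs : {z | relu z ≠ 0} = {z | 0 < relu z ^ 2} := by
    ext z
    simp [sq_pos_iff]
  have hr := measurable_relu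
  have hm : Measurable fun x : ℝ => ρ (Ioi x) :=
    Antitone.measurable fun _ _ h => measure_mono (Ioi_subset_Ioi h)
  rw [Measure.real, activationLevy_Ioi measurable_relu h hx, hs]
  unfold levyTail Measure.real
  rw [integral_toReal]
  · exact (hm.comp (show Measurable fun z => x / relu z ^ 2 by fun_prop)).aemeasurable
  · filter_upwards [ae_restrict_mem (measurableSet_lt measurable_const (by fun_prop))] with z hz
    have hz' : 0 < relu z ^ 2 := hz
    exact h.measure_Ioi_lt_top (by positivity)

theorem hasLogPowerTail_zero_iff {F : ℝ → ℝ} {τ K : ℝ} :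
    HasLogPowerTail F τ 0 K ↔ Tendsto (fun x => x ^ τ * F x) atTop (nhds K) := by
  unfold HasLogPowerTail
  simp only [pow_zero, div_one, mul_comm]

theorem HasLogPowerTail.isEquivalent {F : ℝ → ℝ} {τ K : ℝ} {m : ℕ} (h : HasLogPowerTail F τ m K)
    (hK : K ≠ 0) :
    Asymptotics.IsEquivalent atTop F fun u => K * u ^ (-τ) * Real.log u ^ m := by
  have hne : ∀ᶠ u in atTop, K * u ^ (-τ) * Real.log u ^ m ≠ 0 := by
    filter_upwards [eventually_gt_atTop 1] with u hu
    have h1 := (Real.log_pos hu).ne'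
    have h2 := (Real.rpow_pos_of_pos (zero_lt_one.trans hu) (-τ)).ne'
    positivity
  rw [Asymptotics.isEquivalent_iff_tendsto_one hne]
  have h1 := h.div_const K
  rw [div_self hK] at h1
  refine h1.congr' ?_
  filter_upwards [eventually_gt_atTop 1] with u hu
  have h1 := (Real.log_pos hu).ne'
  have hu0 : 0 < u := zero_lt_one.trans hu
  have h2 := (Real.rpow_pos_of_pos hu0 τ).ne'
  rw [Pi.div_apply, Real.rpow_neg hu0.le]
  field_simp

theorem hasLogPowerTail_of_isEquivalent {F : ℝ → ℝ} {τ c : ℝ} (hc : c ≠ 0)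
    (h : Asymptotics.IsEquivalent atTop F fun y => c * y ^ (-τ)) : HasLogPowerTail F τ 0 c := by
  have hne : ∀ᶠ u : ℝ in atTop, c * u ^ (-τ) ≠ 0 := by
    filter_upwards [eventually_gt_atTop 0] with u hu
    have h2 := (Real.rpow_pos_of_pos hu (-τ)).ne'
    positivity
  rw [Asymptotics.isEquivalent_iff_tendsto_one hne] at h
  rw [hasLogPowerTail_zero_iff]
  have h1 := h.const_mul c
  rw [mul_one] at h1
  refine h1.congr' ?_
  filter_upwards [eventually_gt_atTop 0] with u hu
  have h2 := (Real.rpow_pos_of_pos hu τ).ne'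
  rw [Pi.div_apply, Real.rpow_neg hu.le]
  field_simp

theorem hasLogPowerTail_activationLevy_relu {ρ : Measure ℝ} (h : IsLevyMeasure ρ) {c τ : ℝ}
    (hc : 0 < c) (hτ : 0 < τ)
    (htail : Asymptotics.IsEquivalent atTop (levyTail ρ) fun y => c * y ^ (-τ)) :
    HasLogPowerTail (fun x => (activationLevy relu ρ).real (Ioi x)) τ 0
      (c * (2 ^ (τ - 1) * Real.Gamma (τ + 1 / 2) / √Real.pi)) := by
  have hρ := hasLogPowerTail_of_isEquivalent hc.ne' htail
  have hr := measurable_relu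
  -- The exponent must dominate both `τ` and the blow-up rate `1` of the Lévy tail at `0`, hence `p
  -- = max τ 1`.
  have key := hρ.integral_comp_div (ν := gaussianReal 0 1) (W := fun z => relu z ^ 2)
    (by fun_prop) (ae_of_all _ fun z => sq_nonneg _) (measurable_measureReal_Ioi ρ)
    (fun x hx y _ hxy => measureReal_mono (Ioi_subset_Ioi hxy) (h.measure_Ioi_lt_top hx).ne)
    (fun x _ => measureReal_nonneg) (p := max τ 1) (C := ∫ w, min 1 w ∂ρ) hτ (le_max_left _ _)
    (fun y hy hy1 => ?_) (integrable_relu_sq_rpow_gaussianReal (by positivity))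
  · rw [integral_relu_sq_rpow_gaussianReal hτ] at key
    refine key.congr' ?_
    filter_upwards [eventually_gt_atTop 0] with x hx
    rw [levyTail_activationLevy_relu h hx]
  · refine (h.tail_le hy hy1).trans ?_
    have h0 : 0 ≤ ∫ w, min 1 w ∂ρ := by
      refine integral_nonneg_of_ae ?_
      filter_upwards [h.ae_pos] with w hw
      positivity
    gcongr
    rw [← Real.rpow_neg_one]
    exact Real.rpow_le_rpow_of_exponent_ge hy hy1 (neg_le_neg (le_max_right _ _))

theorem IsInfDivLaw.hasLogPowerTail_relu {ρ μ : Measure ℝ} (hρ : IsLevyMeasure ρ) {a c τ : ℝ}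
    (ha : 0 ≤ a) (hc : 0 < c) (hτ : 0 < τ)
    (htail : Asymptotics.IsEquivalent atTop (levyTail ρ) fun y => c * y ^ (-τ))
    (h : IsInfDivLaw (activationLocation relu a) (activationLevy relu ρ) μ) :
    HasLogPowerTail (fun x => μ.real (Ioi x)) τ 0
      (c * (2 ^ (τ - 1) * Real.Gamma (τ + 1 / 2) / √Real.pi)) := by
  rw [hasLogPowerTail_zero_iff]
  refine h.tendsto_rpow_mul_tail (mul_nonneg ha (integral_nonneg fun z => sq_nonneg _))
    hρ.activationLevy_relu hτ ?_
  exact hasLogPowerTail_zero_iff.1 (hasLogPowerTail_activationLevy_relu hρ hc hτ htail)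

/-! ### Tails of the limiting variances -/

/-- Fubini on the joint law. The set `Y = 0` contributes nothing because `u ≥ 0`, so the default
value of `u / 0` plays no role. -/
theorem measureReal_lt_mul {Ω : Type*} [MeasurableSpace Ω] {P : Measure Ω} [IsProbabilityMeasure P]
    {X Y : Ω → ℝ} (hX : AEMeasurable X P) (hY : AEMeasurable Y P) (hXY : IndepFun X Y P)
    (hY0 : ∀ᵐ ω ∂P, 0 ≤ Y ω) {u : ℝ} (hu : 0 ≤ u) :
    P.real {ω | u < X ω * Y ω} = ∫ y in Ioi 0, (P.map X).real (Ioi (u / y)) ∂(P.map Y) := by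
  have := Measure.isProbabilityMeasure_map hX
  have := Measure.isProbabilityMeasure_map hY
  have hs : MeasurableSet {p : ℝ × ℝ | u < p.1 * p.2} :=
    measurableSet_lt measurable_const (by fun_prop)
  have h1 := (indepFun_iff_map_prod_eq_prod_map_map hX hY).1 hXY
  have h2 : P {ω | u < X ω * Y ω} = ((P.map X).prod (P.map Y)) {p : ℝ × ℝ | u < p.1 * p.2} := by
    rw [← h1, Measure.map_apply_of_aemeasurable (hX.prodMk hY) hs]
    rfl
  have hm : Measurable fun x : ℝ => (P.map X) (Ioi x) :=
    Antitone.measurable fun _ _ h => measure_mono (Ioi_subset_Ioi h)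
  rw [Measure.real, h2, Measure.prod_apply_symm hs]
  unfold Measure.real
  rw [integral_toReal (f := fun y => (P.map X) (Ioi (u / y)))
    (hm.comp (show Measurable fun y : ℝ => u / y by fun_prop)).aemeasurable
    (ae_of_all _ fun y => measure_lt_top _ _), ← lintegral_indicator measurableSet_Ioi]
  congr 1
  refine lintegral_congr_ae ?_
  have hY0' : ∀ᵐ y ∂(P.map Y), 0 ≤ y := (ae_map_iff hY measurableSet_Ici).2 hY0
  filter_upwards [hY0'] with y hy
  rcases hy.eq_or_lt with h | h
  · rw [indicator_of_notMem (by simp [← h])]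
    have : (fun x => (x, y)) ⁻¹' {p : ℝ × ℝ | u < p.1 * p.2} = ∅ := by
      ext x
      simp [← h, hu]
    rw [this, measure_empty]
  · rw [indicator_of_mem (mem_Ioi.2 h)]
    congr 1
    ext x
    simp only [mem_preimage, mem_ofPred_eq, mem_Ioi]
    rw [div_lt_iff₀ h]

theorem measureReal_map_Ioi {Ω : Type*} [MeasurableSpace Ω] {P : Measure Ω} {X : Ω → ℝ}
    (hX : AEMeasurable X P) (u : ℝ) : (P.map X).real (Ioi u) = P.real {ω | u < X ω} := by
  rw [Measure.real, Measure.map_apply_of_aemeasurable hX measurableSet_Ioi]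
  rfl

section LimitVariance

variable {Ω : Type*} {d : ℕ} {x : EuclideanSpace ℝ (Fin d)} {σv : ℝ} {S : ℕ → Ω → ℝ}

theorem limitVariance_one (ω : Ω) : limitVariance 0 σv x S 1 ω = σv ^ 2 * ‖x‖ ^ 2 / d := by
  simp [limitVariance]

theorem limitVariance_succ {l : ℕ} (hl : 1 ≤ l) (ω : Ω) :
    limitVariance 0 σv x S (l + 1) ω = σv ^ 2 * S l ω * limitVariance 0 σv x S l ω := by
  obtain ⟨k, rfl⟩ := Nat.exists_eq_add_of_le' hl
  simp [limitVariance]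

theorem limitVariance_eq_prod (l : ℕ) (ω : Ω) :
    limitVariance 0 σv x S (l + 1) ω =
      ‖x‖ ^ 2 / d * σv ^ (2 * (l + 1)) * ∏ j ∈ Finset.Icc 1 l, S j ω := by
  induction l with
  | zero => rw [limitVariance_one]; simp; ring
  | succ l ih =>
    rw [limitVariance_succ (Nat.le_add_left 1 l), ih, Finset.prod_Icc_succ_top (Nat.le_add_left 1 l)]
    ring

/-- The product is rewritten over the index type of the independent family, so that independence
from a factor outside it can be invoked. -/
theorem limitVariance_eq_prod_subtype {L l : ℕ} (hl : l ≤ L) (ω : Ω) :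
    limitVariance 0 σv x S (l + 1) ω = ‖x‖ ^ 2 / d * σv ^ (2 * (l + 1)) *
      (∏ j ∈ Finset.univ.filter fun j : Finset.Icc 1 L => (j : ℕ) ≤ l, fun ω => S j ω) ω := by
  rw [limitVariance_eq_prod, Finset.prod_apply, Finset.prod_filter,
    Finset.prod_coe_sort (Finset.Icc 1 L) fun j => if j ≤ l then S j ω else 1,
    ← Finset.prod_filter]
  congr 2
  ext j
  simp only [Finset.mem_filter, Finset.mem_Icc]
  omega

variable [MeasurableSpace Ω] {P : Measure Ω} {L : ℕ}

theorem measurable_limitVariance (hSm : ∀ l ∈ Finset.Icc 1 L, Measurable (S l)) {l : ℕ}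
    (hl : l ≤ L) : Measurable (limitVariance 0 σv x S (l + 1)) := by
  have e : limitVariance 0 σv x S (l + 1) =
      fun ω => ‖x‖ ^ 2 / d * σv ^ (2 * (l + 1)) * ∏ j ∈ Finset.Icc 1 l, S j ω :=
    funext fun ω => limitVariance_eq_prod l ω
  rw [e]
  refine (Finset.measurable_fun_prod _ fun j hj => hSm j ?_).const_mul _
  rw [Finset.mem_Icc] at hj ⊢
  omega

theorem ae_limitVariance_nonneg (hS0 : ∀ l ∈ Finset.Icc 1 L, ∀ᵐ ω ∂P, 0 ≤ S l ω) {l : ℕ}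
    (hl : l ≤ L) : ∀ᵐ ω ∂P, 0 ≤ limitVariance 0 σv x S (l + 1) ω := by
  have h : ∀ᵐ ω ∂P, ∀ j ∈ Finset.Icc 1 L, 0 ≤ S j ω := by
    exact (ae_ball_iff (Finset.countable_toSet (Finset.Icc 1 L))).2 hS0
  filter_upwards [h] with ω hω
  rw [limitVariance_eq_prod]
  have h1 : 0 ≤ σv ^ (2 * (l + 1)) := (even_two_mul _).pow_nonneg σv
  refine mul_nonneg (by positivity) (Finset.prod_nonneg fun j hj => hω j ?_)
  rw [Finset.mem_Icc] at hj ⊢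
  omega

theorem indepFun_limitVariance (hSm : ∀ l ∈ Finset.Icc 1 L, Measurable (S l))
    (hSindep : iIndepFun (fun l : Finset.Icc 1 L => S l) P) {l : ℕ} (hl : l + 1 ≤ L) :
    IndepFun (S (l + 1)) (limitVariance 0 σv x S (l + 1)) P := by
  have h := hSindep.indepFun_finsetProd_of_notMem (fun i => hSm i i.2)
    (s := Finset.univ.filter fun j : Finset.Icc 1 L => (j : ℕ) ≤ l)
    (i := ⟨l + 1, by rw [Finset.mem_Icc]; omega⟩) (by simp)
  have e : limitVariance 0 σv x S (l + 1) = (fun y => ‖x‖ ^ 2 / d * σv ^ (2 * (l + 1)) * y) ∘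
      (∏ j ∈ Finset.univ.filter fun j : Finset.Icc 1 L => (j : ℕ) ≤ l, fun ω => S j ω) :=
    funext fun ω => limitVariance_eq_prod_subtype (by omega) ω
  rw [e]
  exact h.symm.comp measurable_id (measurable_const_mul _)

/-- Induction on the number of factors: the next `S` is independent of the current variance,
`HasLogPowerTail.mul` contributes `τ * C / (k + 1)`, and rescaling by `σv ^ 2` contributes its
`τ`-th power. -/
theorem hasLogPowerTail_limitVariance [IsProbabilityMeasure P] (hx : 0 < ‖x‖ ^ 2 / (d : ℝ))
    (hσv : 0 < σv) (hSm : ∀ l ∈ Finset.Icc 1 L, Measurable (S l))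
    (hS0 : ∀ l ∈ Finset.Icc 1 L, ∀ᵐ ω ∂P, 0 ≤ S l ω)
    (hSindep : iIndepFun (fun l : Finset.Icc 1 L => S l) P) {τ C : ℝ} (hτ : 0 < τ)
    (hS : ∀ l ∈ Finset.Icc 1 L, HasLogPowerTail (fun u => (P.map (S l)).real (Ioi u)) τ 0 C)
    (k : ℕ) (hk : k + 1 ≤ L) :
    HasLogPowerTail (fun u => P.real {ω | u < limitVariance 0 σv x S (k + 2) ω}) τ k
      ((‖x‖ ^ 2 / d * σv ^ (2 * (k + 2))) ^ τ * (τ ^ k * C ^ (k + 1) / k.factorial)) := by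
  induction k with
  | zero =>
    have hm1 : 1 ∈ Finset.Icc 1 L := by rw [Finset.mem_Icc]; omega
    have hc : 0 < ‖x‖ ^ 2 / d * σv ^ 4 := by positivity
    have h := (hS 1 hm1).comp_div hc
    simp only [measureReal_map_Ioi (hSm 1 hm1).aemeasurable] at h
    have e : ∀ u ω, u / (‖x‖ ^ 2 / d * σv ^ 4) < S 1 ω ↔ u < limitVariance 0 σv x S (0 + 2) ω := by
      intro u ω
      rw [div_lt_iff₀ hc, limitVariance_eq_prod 1]
      simp [mul_comm]
    simp only [e] at h
    convert h using 1
    simp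
    ring
  | succ k ih =>
    have hml : k + 2 ∈ Finset.Icc 1 L := by rw [Finset.mem_Icc]; omega
    have hVm := measurable_limitVariance (x := x) (σv := σv) hSm (l := k + 1) (by omega)
    have hV0 := ae_limitVariance_nonneg (x := x) (σv := σv) hS0 (l := k + 1) (by omega)
    have := Measure.isProbabilityMeasure_map (μ := P) (hSm _ hml).aemeasurable
    have := Measure.isProbabilityMeasure_map (μ := P) hVm.aemeasurable
    have h1 := HasLogPowerTail.mul (ν := P.map (limitVariance 0 σv x S (k + 2)))
      ((ae_map_iff hVm.aemeasurable measurableSet_Ici).2 hV0) hτ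
      (measurable_measureReal_Ioi (P.map (S (k + 2)))) (fun _ => measureReal_nonneg)
      (fun _ => measureReal_le_one) (hS _ hml)
      (by simpa only [measureReal_map_Ioi hVm.aemeasurable] using ih (by omega))
    have h2 : HasLogPowerTail
        (fun u => P.real {ω | u < S (k + 2) ω * limitVariance 0 σv x S (k + 2) ω}) τ (k + 1)
        (C * (τ * ((‖x‖ ^ 2 / d * σv ^ (2 * (k + 2))) ^ τ * (τ ^ k * C ^ (k + 1) / k.factorial) /
          (k + 1)))) := by
      refine h1.congr' ?_
      filter_upwards [eventually_ge_atTop 0] with u hu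
      exact (measureReal_lt_mul (hSm _ hml).aemeasurable hVm.aemeasurable
        (indepFun_limitVariance hSm hSindep (by omega)) hV0 hu).symm
    have hc : 0 < σv ^ 2 := by positivity
    have h3 := h2.comp_div hc
    have e : ∀ u ω, u / σv ^ 2 < S (k + 2) ω * limitVariance 0 σv x S (k + 2) ω ↔
        u < limitVariance 0 σv x S (k + 1 + 2) ω := by
      intro u ω
      rw [div_lt_iff₀ hc, limitVariance_succ (l := k + 2) (by omega)]
      ring_nf
    simp only [e] at h3
    convert h3 using 1
    have e1 : ‖x‖ ^ 2 / d * σv ^ (2 * (k + 1 + 2)) =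
        ‖x‖ ^ 2 / d * σv ^ (2 * (k + 2)) * σv ^ 2 := by ring
    rw [e1, Real.mul_rpow (by positivity) (by positivity), Nat.factorial_succ]
    push_cast
    field_simp
    ring

end LimitVariance

/-! ### Squared outputs and the final statement -/

theorem HasLogPowerTail.mul_sq_gaussian {Ω : Type*} [MeasurableSpace Ω] {P : Measure Ω}
    [IsProbabilityMeasure P] {V Z : Ω → ℝ} (hV : AEMeasurable V P)
    (hZ : HasLaw Z (gaussianReal 0 1) P) (hZV : IndepFun Z V P) {τ K : ℝ} {m : ℕ} (hτ : 0 < τ)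
    (h : HasLogPowerTail (fun u => P.real {ω | u < V ω}) τ m K) :
    HasLogPowerTail (fun u => P.real {ω | u < V ω * Z ω ^ 2}) τ m
      (K * (2 ^ τ * Real.Gamma (τ + 1 / 2) / √Real.pi)) := by
  have hsq : Measurable fun z : ℝ => z ^ 2 := by fun_prop
  have hZm := hZ.aemeasurable
  have hZ2 : AEMeasurable (fun ω => Z ω ^ 2) P := by fun_prop
  have hmap : P.map (fun ω => Z ω ^ 2) = (gaussianReal 0 1).map fun z => z ^ 2 := by
    rw [← hZ.map_eq, AEMeasurable.map_map_of_aemeasurable hsq.aemeasurable hZm]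
    rfl
  have := Measure.isProbabilityMeasure_map hV
  have := Measure.isProbabilityMeasure_map hZ2
  have hF : ∀ u, P.real {ω | u < V ω} = (P.map V).real (Ioi u) := fun u =>
    (measureReal_map_Ioi hV u).symm
  simp only [hF] at h
  have hpow : ∀ y : ℝ, 0 < y → y ≤ 1 → (P.map V).real (Ioi y) ≤ 1 * y ^ (-τ) := fun y hy hy1 => by
    rw [one_mul]
    exact measureReal_le_one.trans (Real.one_le_rpow_of_pos_of_le_one_of_nonpos hy hy1
      (neg_nonpos.2 hτ.le))
  have hrpow : Measurable fun y : ℝ => y ^ τ := by fun_prop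
  -- A probability tail is at most `1`, hence at most `y ^ (-τ)` on `(0, 1]`, so `p = τ` suffices
  -- here.
  have key := h.integral_comp_div (ν := P.map fun ω => Z ω ^ 2) (W := id) measurable_id
    ((ae_map_iff hZ2 measurableSet_Ici).2 (ae_of_all _ fun ω => sq_nonneg _))
    (measurable_measureReal_Ioi _)
    (fun x _ y _ hxy => measureReal_mono (Ioi_subset_Ioi hxy) (measure_ne_top _ _))
    (fun x _ => measureReal_nonneg) hτ le_rfl hpow ?_
  · have e : ∫ z, id z ^ τ ∂(P.map fun ω => Z ω ^ 2) =
        2 ^ τ * Real.Gamma (τ + 1 / 2) / √Real.pi := by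
      simp only [id]
      rw [hmap, integral_map hsq.aemeasurable hrpow.aestronglyMeasurable]
      exact integral_sq_rpow_gaussianReal hτ
    rw [e] at key
    refine key.congr' ?_
    filter_upwards [eventually_ge_atTop 0] with u hu
    exact (measureReal_lt_mul hV hZ2 (hZV.symm.comp measurable_id hsq)
      (ae_of_all _ fun ω => sq_nonneg _) hu).symm
  · simp only [id]
    rw [hmap, integrable_map_measure hrpow.aestronglyMeasurable hsq.aemeasurable]
    exact integrable_sq_rpow_gaussianReal hτ

/-- No sign condition on `v` is required: for `v ≤ 0` the square root is `0` by convention, and both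
sides fail. -/
theorem lt_mul_sqrt_sq_iff {u z v : ℝ} (hu : 0 ≤ u) : u < (z * √v) ^ 2 ↔ u < v * z ^ 2 := by
  rcases le_total 0 v with hv | hv
  · rw [mul_pow, Real.sq_sqrt hv, mul_comm]
  · rw [Real.sqrt_eq_zero_of_nonpos hv, mul_zero, zero_pow two_ne_zero]
    have := mul_nonpos_of_nonpos_of_nonneg hv (sq_nonneg z)
    constructor <;> intro h <;> linarith

open Asymptotics in
theorem mainTheorem8 {Ω : Type*} [MeasurableSpace Ω] (P : Measure Ω) [IsProbabilityMeasure P]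
    (L d : ℕ) (hL : 1 ≤ L) (hd : 1 ≤ d) (x : EuclideanSpace ℝ (Fin d))
    (σv : ℝ) (hσv : 0 < σv)
    (a : ℝ) (ha : 0 ≤ a) (ρ : Measure ℝ) (hρ : IsLevyMeasure ρ)
    (c τ : ℝ) (hc : 0 < c) (hτ : 0 < τ)
    (htail : levyTail ρ ~[atTop] fun y => c * y ^ (-τ))
    (S : ℕ → Ω → ℝ) (hSm : ∀ l ∈ Finset.Icc 1 L, Measurable (S l))
    (hSlaw : ∀ l ∈ Finset.Icc 1 L,
      IsInfDivLaw (activationLocation relu a) (activationLevy relu ρ) (P.map (S l)))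
    (hSindep : iIndepFun (fun l : Finset.Icc 1 L => S l) P)
    (ε : ℕ → ℕ → Ω → ℝ)
    (hε : ∀ l ∈ Finset.Icc 2 (L + 1), ∀ k ≥ 1, HasLaw (ε l k) (gaussianReal 0 1) P)
    (hεindep : ∀ l ∈ Finset.Icc 2 (L + 1), ∀ k ≥ 1,
      IndepFun (ε l k) (limitVariance 0 σv x S l) P) :
    ∀ l ∈ Finset.Icc 2 (L + 1),
      ((fun u : ℝ => P.real {ω | u < limitVariance 0 σv x S l ω}) ~[atTop]
        fun u : ℝ => (‖x‖ ^ 2 / d * σv ^ (2 * l)) ^ τ *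
          (τ ^ (l - 2) * (c * (2 ^ (τ - 1) * Real.Gamma (τ + 1 / 2) / √Real.pi)) ^ (l - 1) /
            (l - 2).factorial) * u ^ (-τ) * Real.log u ^ (l - 2)) ∧
      ∀ k ≥ 1,
        (fun u : ℝ => P.real {ω | u < (ε l k ω * √(limitVariance 0 σv x S l ω)) ^ 2}) ~[atTop]
          fun u : ℝ => P.real {ω | u < limitVariance 0 σv x S l ω} *
            (2 ^ τ * Real.Gamma (τ + 1 / 2) / Real.Gamma (1 / 2)) := by
  intro l hl
  rw [Finset.mem_Icc] at hl
  obtain ⟨m, rfl⟩ := Nat.exists_eq_add_of_le' hl.1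
  have hd0 : (0 : ℝ) < d := by exact_mod_cast hd
  -- For `x = 0` the limiting constant is `0` and a ratio criterion is useless; there equivalence
  -- means that both sides vanish eventually, which they do because the variance is identically `0`.
  rcases eq_or_ne x 0 with rfl | hx
  · have hV : ∀ ω, limitVariance 0 σv (0 : EuclideanSpace ℝ (Fin d)) S (m + 2) ω = 0 := fun ω => by
      rw [limitVariance_eq_prod (m + 1)]
      simp
    have hempty : ∀ u : ℝ, 0 ≤ u → P.real {_ω : Ω | u < 0} = 0 := fun u hu => by
      simp [not_lt.2 hu]
    simp only [hV, Real.sqrt_zero, mul_zero, ne_eq, OfNat.ofNat_ne_zero, not_false_eq_true,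
      zero_pow, norm_zero, zero_div, zero_mul, Real.zero_rpow hτ.ne']
    refine ⟨EventuallyEq.isEquivalent ?_, fun k _ => EventuallyEq.isEquivalent ?_⟩ <;>
    · filter_upwards [eventually_ge_atTop 0] with u hu
      simp [hempty u hu]
  · have hx0 : 0 < ‖x‖ ^ 2 / (d : ℝ) := by
      have := norm_pos_iff.2 hx
      positivity
    have hS0 : ∀ l ∈ Finset.Icc 1 L, ∀ᵐ ω ∂P, 0 ≤ S l ω := fun l hl =>
      (ae_map_iff (hSm l hl).aemeasurable measurableSet_Ici).1 (hSlaw l hl).ae_nonneg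
    have hV := hasLogPowerTail_limitVariance hx0 hσv hSm hS0 hSindep hτ
      (fun l hl => (hSlaw l hl).hasLogPowerTail_relu hρ ha hc hτ htail) m (by omega)
    have hG : 0 < Real.Gamma (τ + 1 / 2) := Real.Gamma_pos_of_pos (by positivity)
    have hVe := hV.isEquivalent (by positivity)
    refine ⟨hVe, fun k hk => ?_⟩
    have hmem : m + 2 ∈ Finset.Icc 2 (L + 1) := Finset.mem_Icc.2 hl
    have hζ := HasLogPowerTail.mul_sq_gaussian
      (measurable_limitVariance hSm (l := m + 1) (by omega)).aemeasurable
      (hε _ hmem k hk) (hεindep _ hmem k hk) hτ hV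
    have hζe := hζ.isEquivalent (by positivity)
    rw [Real.Gamma_one_half_eq]
    have h1 : (fun u : ℝ => P.real {ω | u < (ε (m + 2) k ω *
        √(limitVariance 0 σv x S (m + 2) ω)) ^ 2}) =ᶠ[atTop]
        fun u => P.real {ω | u < limitVariance 0 σv x S (m + 2) ω * ε (m + 2) k ω ^ 2} := by
      filter_upwards [eventually_ge_atTop 0] with u hu
      simp only [lt_mul_sqrt_sq_iff hu]
    refine h1.isEquivalent.trans (hζe.trans ?_)
    -- Both tails have explicit equivalents that differ by the Gaussian moment, so the second claim
    -- follows by transitivity.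
    refine ((hVe.mul (IsEquivalent.refl
      (u := fun _ => 2 ^ τ * Real.Gamma (τ + 1 / 2) / √Real.pi))).symm).congr_left ?_
    refine Eventually.of_forall fun u => ?_
    simp only [Pi.mul_apply]
    ring
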